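/- Let $d\ge 1$, $s>1/2$, $\mathcal H=L^2(\mathbb R^d)$ (complex valued functions), $H=-\Delta$ as a self-adjoint operator on $\mathcal H$, and let $K=\mathrm{diag}(\sqrt H,-\sqrt H)$ on $\mathcal H\oplus\mathcal H$ with domain $D(\sqrt H)\oplus D(\sqrt H)$. Let $L^{2,s}$ be the space of $u\in L^2(\mathbb R^d)$ with $\|u\|_{L^{2,s}}^2=\int_{\mathbb R^d}|u(x)|^2(1+|x|^2)^s\,dx<\infty$. For a tempered distribution $g_0$ on $\mathbb R^d$, write $h_0=H^{-1/2}g_0\in L^2(\mathbb R^d)$ if the Fourier transform of $g_0$ is the function $\widehat{g_0}(\xi)=2\pi|\xi|\,\widehat{h_0}(\xi)$, where $\widehat u(\xi)=\int e^{-2\pi i x\cdot\xi}u(x)\,dx$. Then: 1. For every $F_0\in\mathcal H\oplus\mathcal H$ there is exactly one mild solution $F(t)=e^{-itK}F_0$ of $F'=-iKF$, $F(0)=F_0$, that is, one continuous $F:\mathbb R\to\mathcal H\oplus\mathcal H$ with $\int_0^tF(\tau)\,d\tau\in D(K)$ and $F(t)=F_0-iK\int_0^tF(\tau)\,d\tau$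 for all $t\in\mathbb R$. For every $\ell<1$ there is a constant $C=C(d,s,\ell)$ such that for all $F_0\in L^{2,s}\oplus L^{2,s}$ and all $T>1$ $$\left\|\frac1{2T}\int_{-T}^Te^{-itK}F_0\,dt\right\|_{\mathcal H\oplus\mathcal H}\le C\,T^{-\ell/2}\,\|F_0\|_{L^{2,s}\oplus L^{2,s}}.$$ 2. For every $f_0\in L^2(\mathbb R^d)$ and every tempered distribution $g_0$ with $h_0=H^{-1/2}g_0\in L^2(\mathbb R^d)$, the wave equation $\partial_t^2f-\Delta f=0$, $f(0)=f_0$, $\partial_tf(0)=g_0$ has exactly one solution $f\in C(\mathbb R;L^2(\mathbb R^d))$, the derivatives being taken in the sense of tempered distributions on $\mathbb R^d$. It is given by the first-order system: $f(t)=F_1(t)+F_2(t)$, where $F(t)=e^{-itK}F_0$ with $F_0=\frac12\,(f_0+ih_0,\;f_0-ih_0)$. 3. For every $\ell<1$ there is a constant $C=C(d,s,\ell)$ such that, if moreover $f_0\in L^{2,s}$ and $H^{-1/2}g_0\in L^{2,s}$, the time average $P^T(f_0,g_0)=\frac1{2T}\int_{-T}^Tf(t)\,dt$ of the solution $f$ satisfies,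 for all $T>1$, $$\left\|P^T(f_0,g_0)\right\|_{L^2(\mathbb R^d)}\le C\,T^{-\ell/2}\left(\|f_0\|_{L^{2,s}}+\|H^{-1/2}g_0\|_{L^{2,s}}\right).$$ 4. For every $q\in(2,\infty]$ there is a constant $C=C(d,s,q)$ such that, for all $f_0,g_0$ as in 3, the map $T\mapsto P^T(f_0,g_0)$ belongs to $L^q([0,\infty);L^2(\mathbb R^d))$ and $$\left\|P^T(f_0,g_0)\right\|_{L^q_TL^2_x([0,\infty)\times\mathbb R^d)}\le C\left(\|f_0\|_{L^{2,s}(\mathbb R^d)}+\|H^{-1/2}g_0\|_{L^{2,s}(\mathbb R^d)}\right).$$ -/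

import Mathlib

open MeasureTheory Filter Topology Complex
open scoped SchwartzMap FourierTransform Laplacian ENNReal NNReal

noncomputable section

namespace WaveErgodic

/-- Euclidean space `ℝ^d`. -/
abbrev Space (d : ℕ) : Type := EuclideanSpace ℝ (Fin d)

/-- The Hilbert space `𝓗 = L²(ℝ^d)` of complex valued functions. -/
abbrev L2 (d : ℕ) : Type := Lp (α := Space d) ℂ 2 volume

/-- The Hilbert space `𝓗 ⊕ 𝓗`. -/
abbrev L2Sum (d : ℕ) : Type := WithLp 2 (L2 d × L2 d)

/-- The domain `{u ∈ L² : m u ∈ L²}` of the operator of multiplication by the function `m`. -/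
def mulDomain (d : ℕ) (m : Space d → ℂ) : Submodule ℂ (L2 d) where
  carrier := {u | MemLp (fun ξ : Space d => m ξ * u ξ) 2 volume}
  zero_mem' := by
    refine (memLp_congr_ae ?_).2 (MemLp.zero (ε := ℂ))
    filter_upwards [Lp.coeFn_zero ℂ 2 (volume : Measure (Space d))] with ξ hξ
    rw [hξ]
    simp
  add_mem' := by
    intro u v hu hv
    refine (memLp_congr_ae ?_).2 (MemLp.add hu hv)
    filter_upwards [Lp.coeFn_add u v] with ξ hξ
    rw [hξ]
    simp [mul_add]
  smul_mem' := by
    intro c u hu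
    refine (memLp_congr_ae ?_).2 (MemLp.const_smul hu c)
    filter_upwards [Lp.coeFn_smul c u] with ξ hξ
    rw [hξ]
    simp [mul_left_comm]

/-- The operator of multiplication by the function `m` on `L²(ℝ^d)`, with its maximal domain. -/
def mulOp (d : ℕ) (m : Space d → ℂ) : L2 d →ₗ.[ℂ] L2 d where
  domain := mulDomain d m
  toFun :=
    { toFun := fun u => MemLp.toLp (fun ξ : Space d => m ξ * (u : L2 d) ξ) u.2
      map_add' := by
        intro u v
        apply Lp.ext
        filter_upwards [MemLp.coeFn_toLp (u + v).2, MemLp.coeFn_toLp u.2, MemLp.coeFn_toLp v.2,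
          Lp.coeFn_add (u : L2 d) (v : L2 d), Lp.coeFn_add (MemLp.toLp _ u.2) (MemLp.toLp _ v.2)]
          with ξ h h1 h2 h3 h4
        rw [h, h4, Pi.add_apply, h1, h2, Submodule.coe_add, h3, Pi.add_apply, mul_add]
      map_smul' := by
        intro c u
        apply Lp.ext
        filter_upwards [MemLp.coeFn_toLp (c • u).2, MemLp.coeFn_toLp u.2,
          Lp.coeFn_smul c (u : L2 d), Lp.coeFn_smul c (MemLp.toLp _ u.2)] with ξ h h1 h3 h4
        rw [h, RingHom.id_apply, h4, Pi.smul_apply, h1, Submodule.coe_smul, h3, Pi.smul_apply,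
          smul_eq_mul, smul_eq_mul, mul_left_comm] }

/-- The function `φ(-Δ)` of the Laplace operator on `L²(ℝ^d)`, with its maximal domain
`{u ∈ L² : φ(4π²|ξ|²) û(ξ) ∈ L²}`. With the normalisation `û(ξ) = ∫ exp(-2πi x·ξ) u(x) dx`,
the unitary Fourier transform turns `-Δ` into multiplication by `4π²|ξ|²`. -/
def funLaplacian (d : ℕ) (φ : ℝ → ℝ) : L2 d →ₗ.[ℂ] L2 d where
  domain := (mulOp d fun ξ => (φ (4 * Real.pi ^ 2 * ‖ξ‖ ^ 2) : ℂ)).domain.comap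
    (Lp.fourierTransformₗᵢ (Space d) ℂ).toLinearEquiv.toLinearMap
  toFun := (Lp.fourierTransformₗᵢ (Space d) ℂ).symm.toLinearEquiv.toLinearMap ∘ₗ
    (mulOp d fun ξ => (φ (4 * Real.pi ^ 2 * ‖ξ‖ ^ 2) : ℂ)).toFun ∘ₗ
      LinearMap.submoduleComap (Lp.fourierTransformₗᵢ (Space d) ℂ).toLinearEquiv.toLinearMap _

/-- The self-adjoint operator `√H` on `L²(ℝ^d)`, where `H = -Δ`. -/
def sqrtH (d : ℕ) : L2 d →ₗ.[ℂ] L2 d := funLaplacian d Real.sqrt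

/-- The block operator `diag(A, B)` on `X ⊕ X`, with domain `D(A) ⊕ D(B)`. -/
def diagOp {X : Type*} [NormedAddCommGroup X] [Module ℂ X] (A B : X →ₗ.[ℂ] X) :
    WithLp 2 (X × X) →ₗ.[ℂ] WithLp 2 (X × X) where
  domain :=
    { carrier := {F | F.fst ∈ A.domain ∧ F.snd ∈ B.domain}
      zero_mem' := ⟨A.domain.zero_mem, B.domain.zero_mem⟩
      add_mem' := fun hF hG => ⟨A.domain.add_mem hF.1 hG.1, B.domain.add_mem hF.2 hG.2⟩
      smul_mem' := fun c _ hF => ⟨A.domain.smul_mem c hF.1, B.domain.smul_mem c hF.2⟩ }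
  toFun :=
    { toFun := fun F => WithLp.toLp 2 (A ⟨F.1.fst, F.2.1⟩, B ⟨F.1.snd, F.2.2⟩)
      map_add' := by
        intro F G
        have h1 := A.map_add ⟨F.1.fst, F.2.1⟩ ⟨G.1.fst, G.2.1⟩
        have h2 := B.map_add ⟨F.1.snd, F.2.2⟩ ⟨G.1.snd, G.2.2⟩
        rw [← WithLp.toLp_add, Prod.mk_add_mk, ← h1, ← h2]
        rfl
      map_smul' := by
        intro c F
        have h1 := A.map_smul c ⟨F.1.fst, F.2.1⟩
        have h2 := B.map_smul c ⟨F.1.snd, F.2.2⟩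
        rw [RingHom.id_apply, ← WithLp.toLp_smul, Prod.smul_mk, ← h1, ← h2]
        rfl }

/-- The self-adjoint operator `K = diag(√H, -√H)` on `𝓗 ⊕ 𝓗`, with domain `D(√H) ⊕ D(√H)`. -/
def opK (d : ℕ) : L2Sum d →ₗ.[ℂ] L2Sum d := diagOp (sqrtH d) (-sqrtH d)

/-- `F(t) = exp(-itK) F₀`: the function `F` is the mild solution of `F' = -iKF`, `F(0) = F₀`,
that is, `F` is continuous and `F(t) = F₀ - iK ∫₀ᵗ F(τ) dτ`, where the integral lies in `D(K)`. -/
def IsFlowOfK {d : ℕ} (F₀ : L2Sum d) (F : ℝ → L2Sum d) : Prop :=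
  Continuous F ∧ ∀ t : ℝ, ∃ h : (∫ τ in (0 : ℝ)..t, F τ) ∈ (opK d).domain,
    F t = F₀ - I • opK d ⟨∫ τ in (0 : ℝ)..t, F τ, h⟩

/-- `f` is the solution, continuous in time with values in `L²(ℝ^d)`, of the wave equation
`∂ₜ²f - Δf = 0`, `f(0) = f₀`, `∂ₜf(0) = g₀`. The time derivatives and the Laplacian are taken in
the sense of tempered distributions on `ℝ^d`; `v` is the velocity `∂ₜf`. -/
def IsWaveSolution {d : ℕ} (f₀ : L2 d) (g₀ : 𝓢'(Space d, ℂ)) (f : ℝ → L2 d) : Prop :=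
  Continuous f ∧ f 0 = f₀ ∧ ∃ v : ℝ → 𝓢'(Space d, ℂ), v 0 = g₀ ∧
    ∀ (φ : 𝓢(Space d, ℂ)) (t : ℝ),
      HasDerivAt (fun τ : ℝ => (f τ : 𝓢'(Space d, ℂ)) φ) (v t φ) t ∧
      HasDerivAt (fun τ : ℝ => v τ φ) ((Δ (f t : 𝓢'(Space d, ℂ))) φ) t

/-- `h = H^{-1/2} g` for a tempered distribution `g` and `h ∈ L²(ℝ^d)`, where `H = -Δ`:
the Fourier transform of `g` is the function `2π|ξ| ĥ(ξ)`. -/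
def IsInvSqrtH {d : ℕ} (g : 𝓢'(Space d, ℂ)) (h : L2 d) : Prop :=
  ∀ ψ : 𝓢(Space d, ℂ),
    (𝓕 g : 𝓢'(Space d, ℂ)) ψ =
      ∫ ξ : Space d, ψ ξ * (((2 * Real.pi * ‖ξ‖ : ℝ) : ℂ) * (𝓕 h : L2 d) ξ)

/-- `u ∈ L^{2,s}(ℝ^d)`, that is, `∫ |u(x)|² (1 + |x|²)^s dx < ∞`. -/
def MemL2s {d : ℕ} (s : ℝ) (u : L2 d) : Prop :=
  Integrable (fun x : Space d => ‖u x‖ ^ 2 * (1 + ‖x‖ ^ 2) ^ s) volume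

/-- The norm of `L^{2,s}(ℝ^d)`. -/
def normL2s {d : ℕ} (s : ℝ) (u : L2 d) : ℝ :=
  Real.sqrt (∫ x : Space d, ‖u x‖ ^ 2 * (1 + ‖x‖ ^ 2) ^ s)

/-- The time average `(1/2T) ∫_{-T}^T f(t) dt`. -/
def timeAverage {X : Type*} [NormedAddCommGroup X] [NormedSpace ℝ X] (f : ℝ → X) (T : ℝ) : X :=
  (2 * T)⁻¹ • ∫ t in (-T)..T, f t

end WaveErgodic

end

/-! The Fourier transform turns `√H` into multiplication by `freq ξ = 2π|ξ|`, so the time average of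
`exp(-it√H)` becomes multiplication by the average of `exp(-it freq ξ)` over `[-T, T]`. This symbol
is at most 1 and at most `1 / (T freq ξ)`, hence its square is at most `2 / (1 + (2πT ξ_i)²)` for
any single coordinate `i`. The decay therefore reduces to showing that `û` has mass of order `1/T`
near the hyperplane `ξ_i = 0`.

`integral_slab_le` shows this without a pointwise trace theorem. The weight `1 / (1 + (2πT ξ_i)²)`
is the real part of the integral of `T⁻¹ exp(-c/T) exp(2πi c ξ_i)` over `c > 0`, so by Plancherel
the mass is a Laplace-type average of the autocorrelation `⟨u, u(· + c e_i)⟩`. For `s > 1/2` this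
autocorrelation is integrable in `c`, with integral at most a constant times `‖u‖²` in `L^{2,s}`
(`mul_le_weighted`, `lintegral_translate_le`), and the kernel is at most `T⁻¹`. Together with
conservation of the norm, which covers small `T`, this gives the rate `(1 + T)^(-1/2)` for all `T >
0`. It implies every rate with `ℓ < 1`, and it lies in `L^q` when `q > 2`.

Well-posedness rests on energy arguments. For `K`, symmetry makes the norm of a difference of
primitives constant. For the wave equation, the difference of two solutions is integrated twice in
time, which gives enough regularity for the classical energy identity. Existence in both cases is
explicit on the Fourier side. -/

namespace WaveErgodic

/-! ### Mild solutions and energy conservation for symmetric operators -/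

section Abstract

variable {H : Type*} [NormedAddCommGroup H] [InnerProductSpace ℂ H]

theorem isFormalAdjoint_neg {A : H →ₗ.[ℂ] H} (hA : A.IsFormalAdjoint A) :
    (-A).IsFormalAdjoint (-A) := by
  intro x y
  rw [LinearPMap.neg_apply, LinearPMap.neg_apply, inner_neg_left, inner_neg_right, hA]

theorem isFormalAdjoint_diagOp {A B : H →ₗ.[ℂ] H} (hA : A.IsFormalAdjoint A)
    (hB : B.IsFormalAdjoint B) : (diagOp A B).IsFormalAdjoint (diagOp A B) := by
  intro x y
  rw [WithLp.prod_inner_apply, WithLp.prod_inner_apply]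
  exact congrArg₂ (· + ·) (hA ⟨x.1.fst, x.2.1⟩ ⟨y.1.fst, y.2.1⟩)
    (hB ⟨x.1.snd, x.2.2⟩ ⟨y.1.snd, y.2.2⟩)

variable [NormedSpace ℝ H]

/-- `u` is the mild solution of `u' = -iAu`, `u(0) = u₀`. -/
def IsMildSolution (A : H →ₗ.[ℂ] H) (u₀ : H) (u : ℝ → H) : Prop :=
  Continuous u ∧ ∀ t : ℝ, ∃ h : (∫ τ in (0 : ℝ)..t, u τ) ∈ A.domain,
    u t = u₀ - I • A ⟨∫ τ in (0 : ℝ)..t, u τ, h⟩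

/-- A differentiable curve which is orthogonal to its velocity is constant in norm. -/
theorem eq_zero_of_re_inner_deriv_eq_zero {G G' : ℝ → H} (hG : ∀ t, HasDerivAt G (G' t) t)
    (h0 : G 0 = 0) (h : ∀ t, (inner ℂ (G t) (G' t)).re = 0) (t : ℝ) : G t = 0 := by
  have hd : ∀ t, HasDerivAt (fun t => inner ℂ (G t) (G t)) 0 t := by
    intro t
    have h1 := (hG t).inner ℂ (hG t)
    have : inner ℂ (G t) (G' t) + inner ℂ (G' t) (G t) = 0 := by
      rw [← inner_conj_symm (G' t) (G t), Complex.add_conj, h t]; simp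
    rwa [this] at h1
  have hc := is_const_of_deriv_eq_zero (fun t => (hd t).differentiableAt) (fun t => (hd t).deriv) t 0
  rw [h0, inner_zero_left] at hc
  exact inner_self_eq_zero.mp hc

/-- Only primitives are known to lie in the domain, so the argument runs on the difference `G` of
the primitives. It satisfies `G' = -iAG`, and `⟨G, AG⟩` is real by symmetry; hence `⟨G, G'⟩` is
imaginary and `G` vanishes identically, and so does its derivative `u - v`. -/
theorem IsMildSolution.unique [CompleteSpace H] {A : H →ₗ.[ℂ] H} (hA : A.IsFormalAdjoint A)
    {u₀ : H} {u v : ℝ → H} (hu : IsMildSolution A u₀ u) (hv : IsMildSolution A u₀ v) : u = v := by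
  obtain ⟨huc, hu⟩ := hu
  obtain ⟨hvc, hv⟩ := hv
  have hG : ∀ t, HasDerivAt (fun t => (∫ τ in (0 : ℝ)..t, u τ) - ∫ τ in (0 : ℝ)..t, v τ)
      (u t - v t) t := fun t =>
    (huc.integral_hasStrictDerivAt 0 t).hasDerivAt.sub (hvc.integral_hasStrictDerivAt 0 t).hasDerivAt
  have hz := eq_zero_of_re_inner_deriv_eq_zero hG (by simp) (fun t => by
    obtain ⟨h1, e1⟩ := hu t
    obtain ⟨h2, e2⟩ := hv t
    set x : A.domain := ⟨∫ τ in (0 : ℝ)..t, u τ, h1⟩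
    set y : A.domain := ⟨∫ τ in (0 : ℝ)..t, v τ, h2⟩
    have e : u t - v t = -(I • A (x - y)) := by
      rw [e1, e2, A.map_sub, smul_sub]; abel
    have hs := hA (x - y) (x - y)
    have hr : (inner ℂ ((x - y : A.domain) : H) (A (x - y))).im = 0 := by
      rw [← Complex.conj_eq_iff_im, inner_conj_symm, hs]
    change (inner ℂ ((x - y : A.domain) : H) (u t - v t)).re = 0
    rw [e, inner_neg_right, inner_smul_right, Complex.neg_re, Complex.I_mul_re, hr, neg_zero, neg_zero])
  funext t
  have h0 : HasDerivAt (fun t => (∫ τ in (0 : ℝ)..t, u τ) - ∫ τ in (0 : ℝ)..t, v τ) 0 t := by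
    have : (fun t => (∫ τ in (0 : ℝ)..t, u τ) - ∫ τ in (0 : ℝ)..t, v τ) = fun _ => (0 : H) :=
      funext hz
    rw [this]
    exact hasDerivAt_const t 0
  exact sub_eq_zero.mp ((hG t).unique h0)

/-- Time reversal turns the group of `√H` into that of `-√H`, the second diagonal entry of `K`. -/
theorem IsMildSolution.neg_time {A : H →ₗ.[ℂ] H} {u₀ : H} {u : ℝ → H}
    (hu : IsMildSolution A u₀ u) : IsMildSolution (-A) u₀ (fun t => u (-t)) := by
  refine ⟨hu.1.comp continuous_neg, fun t => ?_⟩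
  obtain ⟨h, e⟩ := hu.2 (-t)
  have hi : ∫ τ in (0 : ℝ)..t, u (-τ) = -∫ τ in (0 : ℝ)..(-t), u τ := by
    rw [intervalIntegral.integral_comp_neg, neg_zero, intervalIntegral.integral_symm]
  have hm : ∫ τ in (0 : ℝ)..t, u (-τ) ∈ (-A).domain := by
    rw [hi]; exact A.domain.neg_mem h
  refine ⟨hm, ?_⟩
  have : (⟨∫ τ in (0 : ℝ)..t, u (-τ), hm⟩ : A.domain) = -⟨∫ τ in (0 : ℝ)..(-t), u τ, h⟩ :=
    Subtype.ext hi
  rw [LinearPMap.neg_apply]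
  change u (-t) = u₀ - I • -A (⟨∫ τ in (0 : ℝ)..t, u (-τ), hm⟩ : A.domain)
  rw [e, this, A.map_neg, neg_neg]

/-- Conservation of energy: a solution of `W'' = -LW` with `L` symmetric and nonnegative and with
vanishing initial data vanishes. -/
theorem eq_zero_of_energy [IsScalarTower ℝ ℂ H] {W W₁ W₂ : ℝ → H} (hW : ∀ t, HasDerivAt W (W₁ t) t)
    (hW₁ : ∀ t, HasDerivAt W₁ (W₂ t) t) (hc : Continuous W₂) (h0 : W 0 = 0) (h1 : W₁ 0 = 0)
    (hsymm : ∀ s t, inner ℂ (W s) (W₂ t) = inner ℂ (W₂ s) (W t))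
    (hneg : ∀ t, (inner ℂ (W t) (W₂ t)).re ≤ 0) (t : ℝ) : W₂ t = 0 := by
  -- `W₂` is only continuous, so the product rule is not available. Symmetry gives `⟨W t, W₂ r⟩ =
  -- ⟨W₂ t, W r⟩`, which lets the difference quotient be written with increments of `W` alone.
  have hQ : ∀ t, HasDerivAt (fun t => inner ℂ (W t) (W₂ t))
      (inner ℂ (W₁ t) (W₂ t) + inner ℂ (W₂ t) (W₁ t)) t := by
    intro t
    rw [hasDerivAt_iff_tendsto_slope]
    have hs := (hasDerivAt_iff_tendsto_slope.mp (hW t))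
    have hc' : Tendsto W₂ (𝓝[≠] t) (𝓝 (W₂ t)) := (hc.tendsto t).mono_left nhdsWithin_le_nhds
    have hlim := (hs.inner (𝕜 := ℂ) hc').add ((tendsto_const_nhds (x := W₂ t)).inner (𝕜 := ℂ) hs)
    refine hlim.congr fun r => ?_
    simp only [slope, vsub_eq_sub]
    have e1 : inner ℂ ((r - t)⁻¹ • (W r - W t)) (W₂ r) =
        ((r - t)⁻¹ : ℝ) • (inner ℂ (W r) (W₂ r) - inner ℂ (W t) (W₂ r)) := by
      rw [← inner_sub_left, RCLike.real_smul_eq_coe_smul (K := ℂ), inner_smul_left]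
      simp
    have e2 : inner ℂ (W₂ t) ((r - t)⁻¹ • (W r - W t)) =
        ((r - t)⁻¹ : ℝ) • (inner ℂ (W₂ t) (W r) - inner ℂ (W₂ t) (W t)) := by
      rw [← inner_sub_right, RCLike.real_smul_eq_coe_smul (K := ℂ), inner_smul_right]
      simp
    rw [e1, e2, ← smul_add, hsymm t r, ← hsymm t t]
    congr 1
    abel
  have hE : ∀ t, HasDerivAt (fun t => inner ℂ (W₁ t) (W₁ t) - inner ℂ (W t) (W₂ t)) 0 t := by
    intro t
    have := ((hW₁ t).inner ℂ (hW₁ t)).sub (hQ t)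
    rwa [sub_self] at this
  have hz : ∀ t, W₁ t = 0 := by
    intro t
    have hcst := is_const_of_deriv_eq_zero (fun t => (hE t).differentiableAt)
      (fun t => (hE t).deriv) t 0
    simp only [h0, h1, inner_zero_left, sub_zero] at hcst
    have hre := congrArg Complex.re hcst
    rw [Complex.sub_re, Complex.zero_re] at hre
    -- The conserved energy is `‖W₁‖² - ⟨W, W₂⟩`; it starts at zero and both of its terms have
    -- nonnegative real part.
    have h2 : (inner ℂ (W₁ t) (W₁ t)).re ≤ 0 := by linarith [hneg t]
    exact norm_eq_zero.mp (by
      rw [← sq_eq_zero_iff]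
      exact le_antisymm ((inner_self_eq_norm_sq (𝕜 := ℂ) (W₁ t)).symm.trans_le h2) (sq_nonneg _))
  have h2 : HasDerivAt W₁ 0 t := by
    rw [funext hz]; exact hasDerivAt_const t (0 : H)
  exact (hW₁ t).unique h2

end Abstract

/-! ### Symmetry of `K` and uniqueness of its flow -/

theorem isFormalAdjoint_mulOp (d : ℕ) (m : Space d → ℝ) :
    (mulOp d fun ξ => (m ξ : ℂ)).IsFormalAdjoint (mulOp d fun ξ => (m ξ : ℂ)) := by
  intro x y
  rw [L2.inner_def, L2.inner_def]
  refine integral_congr_ae ?_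
  filter_upwards [MemLp.coeFn_toLp x.2, MemLp.coeFn_toLp y.2] with ξ h1 h2
  change inner ℂ ((MemLp.toLp _ x.2 : L2 d) ξ) _ = inner ℂ _ ((MemLp.toLp _ y.2 : L2 d) ξ)
  rw [h1, h2]
  simp only [RCLike.inner_apply, map_mul, Complex.conj_ofReal]
  ring

theorem fourier_mem_mulDomain {d : ℕ} {φ : ℝ → ℝ} {x : L2 d}
    (hx : x ∈ (funLaplacian d φ).domain) :
    Lp.fourierTransformₗᵢ (Space d) ℂ x ∈
      mulDomain d (fun ξ => (φ (4 * Real.pi ^ 2 * ‖ξ‖ ^ 2) : ℂ)) := hx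

theorem funLaplacian_apply {d : ℕ} {φ : ℝ → ℝ} (x : (funLaplacian d φ).domain) :
    funLaplacian d φ x = (Lp.fourierTransformₗᵢ (Space d) ℂ).symm
      (mulOp d (fun ξ => (φ (4 * Real.pi ^ 2 * ‖ξ‖ ^ 2) : ℂ))
        ⟨Lp.fourierTransformₗᵢ (Space d) ℂ x, fourier_mem_mulDomain x.2⟩) := by
  rfl

theorem isFormalAdjoint_funLaplacian (d : ℕ) (φ : ℝ → ℝ) :
    (funLaplacian d φ).IsFormalAdjoint (funLaplacian d φ) := by
  intro x y
  have h := isFormalAdjoint_mulOp d (fun ξ => φ (4 * Real.pi ^ 2 * ‖ξ‖ ^ 2))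
    ⟨_, fourier_mem_mulDomain x.2⟩ ⟨_, fourier_mem_mulDomain y.2⟩
  rw [funLaplacian_apply, funLaplacian_apply,
    ← (Lp.fourierTransformₗᵢ (Space d) ℂ).inner_map_map,
    ← (Lp.fourierTransformₗᵢ (Space d) ℂ).inner_map_map (x : L2 d),
    LinearIsometryEquiv.apply_symm_apply, LinearIsometryEquiv.apply_symm_apply]
  exact h

theorem isFormalAdjoint_opK (d : ℕ) : (opK d).IsFormalAdjoint (opK d) :=
  isFormalAdjoint_diagOp (isFormalAdjoint_funLaplacian d _)
    (isFormalAdjoint_neg (isFormalAdjoint_funLaplacian d _))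

theorem IsFlowOfK.unique {d : ℕ} {F₀ : L2Sum d} {F G : ℝ → L2Sum d} (hF : IsFlowOfK F₀ F)
    (hG : IsFlowOfK F₀ G) : F = G :=
  IsMildSolution.unique (isFormalAdjoint_opK d) hF hG

theorem IsMildSolution.isFlowOfK {d : ℕ} {F₀ : L2Sum d} {u v : ℝ → L2 d}
    (hu : IsMildSolution (sqrtH d) F₀.fst u) (hv : IsMildSolution (-sqrtH d) F₀.snd v) :
    IsFlowOfK F₀ (fun t => WithLp.toLp 2 (u t, v t)) := by
  have hc : Continuous (fun t => WithLp.toLp 2 (u t, v t)) :=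
    (WithLp.prod_continuous_toLp 2 _ _).comp (hu.1.prodMk hv.1)
  refine ⟨hc, fun t => ?_⟩
  obtain ⟨h1, e1⟩ := hu.2 t
  obtain ⟨h2, e2⟩ := hv.2 t
  have hi := hc.intervalIntegrable (μ := volume) 0 t
  have i1 : (∫ τ in (0 : ℝ)..t, WithLp.toLp 2 (u τ, v τ)).fst = ∫ τ in (0 : ℝ)..t, u τ :=
    ((WithLp.fstL 2 ℂ (L2 d) (L2 d)).intervalIntegral_comp_comm hi).symm
  have i2 : (∫ τ in (0 : ℝ)..t, WithLp.toLp 2 (u τ, v τ)).snd = ∫ τ in (0 : ℝ)..t, v τ :=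
    ((WithLp.sndL 2 ℂ (L2 d) (L2 d)).intervalIntegral_comp_comm hi).symm
  have hm : (∫ τ in (0 : ℝ)..t, WithLp.toLp 2 (u τ, v τ)) ∈ (opK d).domain :=
    ⟨by rw [i1]; exact h1, by rw [i2]; exact h2⟩
  refine ⟨hm, ?_⟩
  have a1 : (⟨(∫ τ in (0 : ℝ)..t, WithLp.toLp 2 (u τ, v τ)).fst, hm.1⟩ : (sqrtH d).domain) =
    ⟨_, h1⟩ := Subtype.ext i1
  have a2 : (⟨(∫ τ in (0 : ℝ)..t, WithLp.toLp 2 (u τ, v τ)).snd, hm.2⟩ : (-sqrtH d).domain) =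
    ⟨_, h2⟩ := Subtype.ext i2
  have e : opK d ⟨_, hm⟩ = WithLp.toLp 2 (sqrtH d ⟨_, h1⟩, (-sqrtH d) ⟨_, h2⟩) := by
    rw [← a1, ← a2]; rfl
  change WithLp.toLp 2 (u t, v t) = F₀ - I • opK d ⟨_, hm⟩
  rw [e, e1, e2]
  rfl

/-! ### The half-wave group and its time integrals on the Fourier side -/

variable {d : ℕ}

theorem norm_sq_eq_integral (u : L2 d) : ‖u‖ ^ 2 = ∫ ξ, ‖u ξ‖ ^ 2 := by
  have h := inner_self_eq_norm_sq_to_K (𝕜 := ℂ) u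
  rw [L2.inner_def] at h
  simp only [inner_self_eq_norm_sq_to_K] at h
  norm_cast at h
  rw [← h]

theorem integrable_norm_sq (u : L2 d) : Integrable (fun ξ => ‖u ξ‖ ^ 2) :=
  (Lp.memLp u).integrable_norm_pow two_ne_zero

/-- Multiplication by an essentially bounded function on `L²(ℝ^d)`. -/
noncomputable def boundedMul (m : Space d → ℂ) (hm : MemLp m ∞ volume) : L2 d →L[ℂ] L2 d :=
  (ContinuousLinearMap.lsmul ℂ ℂ).holderL volume ∞ 2 2 (hm.toLp m)

theorem coeFn_boundedMul (m : Space d → ℂ) (hm : MemLp m ∞ volume) (u : L2 d) :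
    boundedMul m hm u =ᵐ[volume] fun ξ => m ξ * u ξ := by
  have h := (ContinuousLinearMap.lsmul ℂ ℂ).coeFn_holder (r := 2) (hm.toLp m) u
  filter_upwards [h, hm.coeFn_toLp] with ξ h1 h2
  rw [← h2]
  exact h1

theorem memLp_top_exp {f : Space d → ℝ} (hf : Continuous f) :
    MemLp (fun ξ => exp (f ξ * I)) ∞ volume :=
  memLp_top_of_bound (by fun_prop) 1 (.of_forall fun ξ => (norm_exp_ofReal_mul_I _).le)

/-- The symbol of `√(-Δ)`. -/
noncomputable def freq (ξ : Space d) : ℝ := 2 * Real.pi * ‖ξ‖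

@[fun_prop]
theorem continuous_freq : Continuous (freq (d := d)) := by
  unfold freq; fun_prop

theorem freq_nonneg (ξ : Space d) : 0 ≤ freq ξ := by
  unfold freq; positivity

theorem sqrt_symbol (ξ : Space d) : √(4 * Real.pi ^ 2 * ‖ξ‖ ^ 2) = freq ξ := by
  rw [show 4 * Real.pi ^ 2 * ‖ξ‖ ^ 2 = freq ξ ^ 2 by unfold freq; ring, Real.sqrt_sq (freq_nonneg ξ)]

/-- The group `exp(-it√(-Δ))` on the Fourier side. -/
noncomputable def halfWave (d : ℕ) (t : ℝ) : L2 d →L[ℂ] L2 d :=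
  boundedMul (fun ξ => exp ((-(t * freq ξ) : ℝ) * I)) (memLp_top_exp (by fun_prop))

theorem coeFn_halfWave (t : ℝ) (u : L2 d) :
    halfWave d t u =ᵐ[volume] fun ξ => exp ((-(t * freq ξ) : ℝ) * I) * u ξ :=
  coeFn_boundedMul _ _ u

theorem halfWave_zero (u : L2 d) : halfWave d 0 u = u := by
  apply Lp.ext
  filter_upwards [coeFn_halfWave 0 u] with ξ h
  simp [h]

/-- Continuity is only strong, because `freq` is unbounded: it follows by dominated convergence for
each fixed `u`. -/
theorem continuous_halfWave (u : L2 d) : Continuous fun t => halfWave d t u := by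
  rw [continuous_iff_continuousAt]
  intro t₀
  rw [ContinuousAt, tendsto_iff_norm_sub_tendsto_zero]
  have hsq : ∀ t, ‖halfWave d t u - halfWave d t₀ u‖ ^ 2 =
      ∫ ξ, ‖(exp ((-(t * freq ξ) : ℝ) * I) - exp ((-(t₀ * freq ξ) : ℝ) * I)) * u ξ‖ ^ 2 := by
    intro t
    rw [norm_sq_eq_integral]
    refine integral_congr_ae ?_
    filter_upwards [coeFn_halfWave t u, coeFn_halfWave t₀ u,
      Lp.coeFn_sub (halfWave d t u) (halfWave d t₀ u)] with ξ h1 h2 h3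
    rw [h3, Pi.sub_apply, h1, h2, sub_mul]
  have hlim : Tendsto (fun t => ‖halfWave d t u - halfWave d t₀ u‖ ^ 2) (𝓝 t₀) (𝓝 0) := by
    simp_rw [hsq]
    have : (0 : ℝ) = ∫ ξ : Space d, ‖(exp ((-(t₀ * freq ξ) : ℝ) * I) -
        exp ((-(t₀ * freq ξ) : ℝ) * I)) * u ξ‖ ^ 2 := by simp
    rw [this]
    -- Two unimodular numbers differ by at most 2, whence the factor 4.
    refine tendsto_integral_filter_of_dominated_convergence (fun ξ => 4 * ‖u ξ‖ ^ 2) ?_ ?_ ?_ ?_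
    · refine .of_forall fun t => ?_
      have hu := Lp.aestronglyMeasurable u
      have hc : Continuous fun ξ : Space d =>
        exp ((-(t * freq ξ) : ℝ) * I) - exp ((-(t₀ * freq ξ) : ℝ) * I) := by fun_prop
      exact (hc.aestronglyMeasurable.mul hu).norm.pow 2
    · refine .of_forall fun t => .of_forall fun ξ => ?_
      rw [norm_mul, mul_pow, norm_mul, Real.norm_of_nonneg (by positivity),
        Real.norm_of_nonneg (by positivity)]
      gcongr
      have h := norm_sub_le (exp ((-(t * freq ξ) : ℝ) * I)) (exp ((-(t₀ * freq ξ) : ℝ) * I))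
      rw [norm_exp_ofReal_mul_I, norm_exp_ofReal_mul_I] at h
      nlinarith [norm_nonneg (exp ((-(t * freq ξ) : ℝ) * I) - exp ((-(t₀ * freq ξ) : ℝ) * I))]
    · exact (integrable_norm_sq u).const_mul 4
    · refine .of_forall fun ξ => ?_
      have : Continuous fun t : ℝ => ‖(exp ((-(t * freq ξ) : ℝ) * I) -
        exp ((-(t₀ * freq ξ) : ℝ) * I)) * u ξ‖ ^ 2 := by fun_prop
      exact this.tendsto t₀
  have := hlim.sqrt
  simpa using this

/-- The symbol of the integral of the group `exp(-it√(-Δ))` over `[a, b]`. -/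
noncomputable def integralSymbol (a b : ℝ) (ξ : Space d) : ℂ :=
  ∫ t in a..b, exp ((-(t * freq ξ) : ℝ) * I)

theorem norm_integralSymbol_le (a b : ℝ) (ξ : Space d) : ‖integralSymbol a b ξ‖ ≤ |b - a| := by
  have := intervalIntegral.norm_integral_le_of_norm_le_const (a := a) (b := b)
    (f := fun t => exp ((-(t * freq ξ) : ℝ) * I)) (C := 1)
    (fun t _ => (norm_exp_ofReal_mul_I _).le)
  rwa [one_mul] at this

/-- The product form avoids dividing by `freq`, which vanishes at the origin. It serves twice: the
product is bounded, which puts primitives in the domain of `√H`, and it gives the `1/T` decay of the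
averaged symbol. -/
theorem freq_mul_integralSymbol (a b : ℝ) (ξ : Space d) :
    freq ξ * integralSymbol a b ξ =
      I * (exp ((-(b * freq ξ) : ℝ) * I) - exp ((-(a * freq ξ) : ℝ) * I)) := by
  have h : ∀ t ∈ Set.uIcc a b, HasDerivAt (fun t : ℝ => I * exp ((-(t * freq ξ) : ℝ) * I))
      (freq ξ * exp ((-(t * freq ξ) : ℝ) * I)) t := by
    intro t _
    have h1 : HasDerivAt (fun t : ℝ => ((-(t * freq ξ) : ℝ) : ℂ) * I)
        (((-(1 * freq ξ) : ℝ) : ℂ) * I) t :=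
      (((hasDerivAt_id t).mul_const (freq ξ)).neg.ofReal_comp).mul_const I
    refine (h1.cexp.const_mul I).congr_deriv ?_
    push_cast
    linear_combination (-(freq ξ : ℂ) * exp (-(t * freq ξ) * I)) * I_mul_I
  have hi : IntervalIntegrable (fun t : ℝ => (freq ξ : ℂ) * exp ((-(t * freq ξ) : ℝ) * I))
      volume a b := Continuous.intervalIntegrable (by fun_prop) _ _
  rw [integralSymbol, ← intervalIntegral.integral_const_mul,
    intervalIntegral.integral_eq_sub_of_hasDerivAt h hi, mul_sub]

theorem continuous_integralSymbol (a b : ℝ) : Continuous (integralSymbol (d := d) a b) := by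
  unfold integralSymbol
  exact intervalIntegral.continuous_parametric_intervalIntegral_of_continuous' (by fun_prop) a b

theorem memLp_integralSymbol (a b : ℝ) : MemLp (integralSymbol (d := d) a b) ∞ volume :=
  memLp_top_of_bound (continuous_integralSymbol a b).aestronglyMeasurable _
    (.of_forall fun ξ => norm_integralSymbol_le a b ξ)

/-- The Bochner integral in `L²` is identified with a pointwise multiplier by pairing with an
arbitrary `v` and applying Fubini. -/
theorem integral_halfWave (a b : ℝ) (u : L2 d) :
    ∫ t in a..b, halfWave d t u = boundedMul (integralSymbol a b) (memLp_integralSymbol a b) u := by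
  refine ext_inner_left ℂ fun v => ?_
  have hi := (continuous_halfWave u).intervalIntegrable (μ := volume) a b
  rw [← innerSL_apply_apply ℂ v (∫ t in a..b, halfWave d t u),
    ← (innerSL ℂ v).intervalIntegral_comp_comm hi]
  simp only [innerSL_apply_apply, L2.inner_def]
  have e1 : ∀ t : ℝ, (∫ ξ, inner ℂ (v ξ) (halfWave d t u ξ)) =
      ∫ ξ, exp ((-(t * freq ξ) : ℝ) * I) * inner ℂ (v ξ) (u ξ) := by
    intro t
    refine integral_congr_ae ?_
    filter_upwards [coeFn_halfWave t u] with ξ h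
    rw [h, ← smul_eq_mul, inner_smul_right]
  simp_rw [e1]
  rw [intervalIntegral_integral_swap]
  · refine integral_congr_ae ?_
    filter_upwards [coeFn_boundedMul _ (memLp_integralSymbol a b) u] with ξ h
    rw [h, ← smul_eq_mul, inner_smul_right, intervalIntegral.integral_mul_const, integralSymbol]
  · have : IsFiniteMeasure ((volume : Measure ℝ).restrict (Set.uIoc a b)) := by
      rw [Set.uIoc]; infer_instance
    have h1 : Integrable (fun z : ℝ × Space d => inner ℂ (v z.2) (u z.2))
        ((volume.restrict (Set.uIoc a b)).prod volume) :=
      (L2.integrable_inner (𝕜 := ℂ) v u).comp_snd _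
    refine h1.bdd_mul (c := 1) (Continuous.aestronglyMeasurable (by fun_prop))
      (.of_forall fun z => (norm_exp_ofReal_mul_I _).le)

/-- The group `exp(-it√(-Δ))` on `L²(ℝ^d)`. -/
noncomputable def halfFlow (u : L2 d) (t : ℝ) : L2 d :=
  (Lp.fourierTransformₗᵢ (Space d) ℂ).symm (halfWave d t (Lp.fourierTransformₗᵢ (Space d) ℂ u))

theorem continuous_halfFlow (u : L2 d) : Continuous (halfFlow u) :=
  (LinearIsometryEquiv.continuous _).comp (continuous_halfWave _)

theorem fourier_integral_halfFlow (a b : ℝ) (u : L2 d) :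
    Lp.fourierTransformₗᵢ (Space d) ℂ (∫ t in a..b, halfFlow u t) =
      boundedMul (integralSymbol a b) (memLp_integralSymbol a b)
        (Lp.fourierTransformₗᵢ (Space d) ℂ u) := by
  have h := (Lp.fourierTransformₗᵢ (Space d) ℂ).toContinuousLinearEquiv.toContinuousLinearMap
    |>.intervalIntegral_comp_comm ((continuous_halfFlow u).intervalIntegrable (μ := volume) a b)
  refine h.symm.trans ?_
  rw [← integral_halfWave]
  refine intervalIntegral.integral_congr fun t _ => ?_
  exact (Lp.fourierTransformₗᵢ (Space d) ℂ).apply_symm_apply _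

/-- Integration in time gains one power of `freq`: by `freq_mul_integralSymbol` the primitive lies
in the domain of `√H` for every `u` in `L²`, although `halfFlow u t` itself need not. -/
theorem isMildSolution_halfFlow (u : L2 d) : IsMildSolution (sqrtH d) u (halfFlow u) := by
  refine ⟨continuous_halfFlow u, fun t => ?_⟩
  set U := Lp.fourierTransformₗᵢ (Space d) ℂ with hU
  have key : (fun ξ => ((√(4 * Real.pi ^ 2 * ‖ξ‖ ^ 2) : ℝ) : ℂ) *
      (U (∫ τ in (0 : ℝ)..t, halfFlow u τ)) ξ) =ᵐ[volume] (I • (halfWave d t (U u) - U u) : L2 d) := by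
    rw [hU, fourier_integral_halfFlow, ← hU]
    filter_upwards [coeFn_boundedMul _ (memLp_integralSymbol 0 t) (U u), coeFn_halfWave t (U u),
      Lp.coeFn_sub (halfWave d t (U u)) (U u), Lp.coeFn_smul I (halfWave d t (U u) - U u)]
      with ξ h1 h2 h3 h4
    rw [h1, h4, Pi.smul_apply, h3, Pi.sub_apply, h2, sqrt_symbol, ← mul_assoc,
      freq_mul_integralSymbol, smul_eq_mul]
    simp
    ring
  have hm : (∫ τ in (0 : ℝ)..t, halfFlow u τ) ∈ (sqrtH d).domain :=
    (memLp_congr_ae key).2 (Lp.memLp _)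
  refine ⟨hm, ?_⟩
  have e : sqrtH d ⟨_, hm⟩ = U.symm (I • (halfWave d t (U u) - U u)) := by
    refine (funLaplacian_apply (φ := Real.sqrt) ⟨_, hm⟩).trans ?_
    refine congrArg U.symm (Lp.ext ?_)
    exact (MemLp.coeFn_toLp (fourier_mem_mulDomain hm)).trans key
  rw [e, ← U.symm.map_smul, smul_smul, I_mul_I, neg_one_smul, map_neg, map_sub,
    U.symm_apply_apply, halfFlow, ← hU]
  abel

/-- The flow of `K` in terms of the group `exp(-it√(-Δ))`. -/
theorem isFlowOfK_halfFlow (F₀ : L2Sum d) :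
    IsFlowOfK F₀ (fun t => WithLp.toLp 2 (halfFlow F₀.fst t, halfFlow F₀.snd (-t))) :=
  (isMildSolution_halfFlow _).isFlowOfK (isMildSolution_halfFlow _).neg_time

theorem IsFlowOfK.eq_halfFlow {F₀ : L2Sum d} {F : ℝ → L2Sum d} (hF : IsFlowOfK F₀ F) :
    F = fun t => WithLp.toLp 2 (halfFlow F₀.fst t, halfFlow F₀.snd (-t)) :=
  hF.unique (isFlowOfK_halfFlow F₀)

theorem existsUnique_isFlowOfK (F₀ : L2Sum d) : ∃! F, IsFlowOfK F₀ F :=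
  ⟨_, isFlowOfK_halfFlow F₀, fun _ hF => hF.eq_halfFlow⟩

/-! ### Translations and integrability of the autocorrelation -/

/-- The translation `u ↦ u(· + a)` on `L²(ℝ^d)`. -/
noncomputable def translate (a : Space d) : L2 d →ₗᵢ[ℂ] L2 d :=
  Lp.compMeasurePreservingₗᵢ ℂ (· + a) (measurePreserving_add_right volume a)

theorem coeFn_translate (a : Space d) (u : L2 d) :
    translate a u =ᵐ[volume] fun x => u (x + a) :=
  Lp.coeFn_compMeasurePreserving u (measurePreserving_add_right volume a)

/-- Both sides are continuous in `u`, so Schwartz functions suffice, where this is the classical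
change of variables. -/
theorem fourier_translate (a : Space d) (u : L2 d) :
    Lp.fourierTransformₗᵢ (Space d) ℂ (translate a u) =
      boundedMul (fun ξ => exp ((2 * Real.pi * inner ℝ a ξ : ℝ) * I)) (memLp_top_exp (by fun_prop))
        (Lp.fourierTransformₗᵢ (Space d) ℂ u) := by
  refine DenseRange.induction_on
    (SchwartzMap.denseRange_toLpCLM (E := Space d) (F := ℂ) (p := 2) ENNReal.ofNat_ne_top) u ?_ ?_
  · refine isClosed_eq ?_ ?_
    · exact (LinearIsometryEquiv.continuous _).comp (LinearIsometry.continuous _)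
    · exact (ContinuousLinearMap.continuous _).comp (LinearIsometryEquiv.continuous _)
  intro f
  rw [SchwartzMap.toLpCLM_apply]
  have e1 : translate a (f.toLp 2 volume) =
      (SchwartzMap.compSubConstCLM ℂ (-a) f).toLp 2 volume := by
    apply Lp.ext
    have hq := (measurePreserving_add_right (volume : Measure (Space d)) a).quasiMeasurePreserving
    filter_upwards [coeFn_translate a (f.toLp 2 volume), hq.ae (f.coeFn_toLp 2 volume),
      (SchwartzMap.compSubConstCLM ℂ (-a) f).coeFn_toLp 2 volume] with x h1 h2 h3
    rw [h3, h1, h2, SchwartzMap.compSubConstCLM_apply, sub_neg_eq_add]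
  rw [e1]
  have e2 : ∀ g : 𝓢(Space d, ℂ), Lp.fourierTransformₗᵢ (Space d) ℂ (g.toLp 2 volume) =
      (𝓕 g).toLp 2 volume := fun g => g.toLp_fourier_eq
  rw [e2, e2]
  apply Lp.ext
  filter_upwards [coeFn_boundedMul _ (memLp_top_exp (f := fun ξ : Space d =>
    2 * Real.pi * inner ℝ a ξ) (by fun_prop)) ((𝓕 f).toLp 2 volume), (𝓕 f).coeFn_toLp 2 volume,
    (𝓕 (SchwartzMap.compSubConstCLM ℂ (-a) f)).coeFn_toLp 2 volume] with ξ h1 h2 h3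
  rw [h1, h2, h3, SchwartzMap.fourier_coe, SchwartzMap.fourier_coe]
  have := congrFun (VectorFourier.fourierIntegral_comp_add_right Real.fourierChar
    (volume : Measure (Space d)) (innerₗ (Space d)) f a) ξ
  have hf : ⇑(SchwartzMap.compSubConstCLM ℂ (-a) f) = f ∘ fun v => v + a := by
    ext v
    simp
  rw [hf]
  refine this.trans ?_
  rw [Circle.smul_def, Real.fourierChar_apply]
  rfl

/-- This is how `û` enters the slab estimate: the autocorrelation of `u` is the inverse Fourier
transform of `|û|²`. -/
theorem inner_translate (a : Space d) (u : L2 d) :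
    inner ℂ u (translate a u) = ∫ ξ, exp ((2 * Real.pi * inner ℝ a ξ : ℝ) * I) *
      ((‖Lp.fourierTransformₗᵢ (Space d) ℂ u ξ‖ ^ 2 : ℝ) : ℂ) := by
  rw [← (Lp.fourierTransformₗᵢ (Space d) ℂ).inner_map_map, fourier_translate, L2.inner_def]
  refine integral_congr_ae ?_
  filter_upwards [coeFn_boundedMul _ (memLp_top_exp (f := fun ξ : Space d =>
    2 * Real.pi * inner ℝ a ξ) (by fun_prop)) (Lp.fourierTransformₗᵢ (Space d) ℂ u)] with ξ h
  rw [h, ← smul_eq_mul, inner_smul_right, inner_self_eq_norm_sq_to_K]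
  norm_cast

/-- With `A = (1 + x_i²)^s` and `B = (1 + y_i²)^s`, the arithmetic-geometric inequality gives `2ab ≤
a² A/B + b² B/A`. In each term the full weight stays on one function, and the compensating factor
depends on one coordinate of the other point only. -/
theorem mul_le_weighted {s : ℝ} (hs : 0 ≤ s) (i : Fin d) (a b : ℝ) (ha : 0 ≤ a) (hb : 0 ≤ b)
    (x y : Space d) :
    a * b ≤ a ^ 2 * (1 + ‖x‖ ^ 2) ^ s * (1 + y i ^ 2) ^ (-s) +
      b ^ 2 * (1 + ‖y‖ ^ 2) ^ s * (1 + x i ^ 2) ^ (-s) := by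
  have hle : ∀ z : Space d, (1 + z i ^ 2) ^ s ≤ (1 + ‖z‖ ^ 2) ^ s := by
    intro z
    have : z i ^ 2 ≤ ‖z‖ ^ 2 := by
      rw [← sq_abs, ← Real.norm_eq_abs]
      gcongr
      exact PiLp.norm_apply_le z i
    gcongr
  have hpos : ∀ z : Space d, 0 < (1 + z i ^ 2) ^ s := fun z => by positivity
  have hneg : ∀ z : Space d, (1 + z i ^ 2) ^ (-s) = ((1 + z i ^ 2) ^ s)⁻¹ := fun z =>
    Real.rpow_neg (by positivity) s
  have h1 : a ^ 2 * (1 + x i ^ 2) ^ s * ((1 + y i ^ 2) ^ s)⁻¹ ≤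
      a ^ 2 * (1 + ‖x‖ ^ 2) ^ s * ((1 + y i ^ 2) ^ s)⁻¹ := by
    exact mul_le_mul_of_nonneg_right (mul_le_mul_of_nonneg_left (hle x) (sq_nonneg a))
      (inv_nonneg.mpr (hpos y).le)
  have h2 : b ^ 2 * (1 + y i ^ 2) ^ s * ((1 + x i ^ 2) ^ s)⁻¹ ≤
      b ^ 2 * (1 + ‖y‖ ^ 2) ^ s * ((1 + x i ^ 2) ^ s)⁻¹ := by
    exact mul_le_mul_of_nonneg_right (mul_le_mul_of_nonneg_left (hle y) (sq_nonneg b))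
      (inv_nonneg.mpr (hpos x).le)
  rw [hneg, hneg]
  refine le_trans ?_ (add_le_add h1 h2)
  have hA := hpos x
  have hB := hpos y
  set A := (1 + x i ^ 2) ^ s
  set B := (1 + y i ^ 2) ^ s
  rw [← div_eq_mul_inv, ← div_eq_mul_inv, div_add_div _ _ hB.ne' hA.ne', le_div_iff₀ (by positivity)]
  nlinarith [sq_nonneg (a * A - b * B), mul_nonneg (mul_nonneg ha hb) (mul_pos hB hA).le]

/-- For `y = x + c e_i` the compensating factors depend on `x_i + c` and on `x_i`. After moving `x`
by `c e_i` in the second term, each has a `c`-integral independent of `x`, so Tonelli separates the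
two integrals; the factor 2 counts the two terms. -/
theorem lintegral_translate_le {s : ℝ} (hs : 0 ≤ s) (i : Fin d) (u : L2 d) :
    ∫⁻ c : ℝ, ∫⁻ x : Space d,
      ENNReal.ofReal (‖u x‖ * ‖u (x + c • EuclideanSpace.single i (1 : ℝ))‖) ≤
    2 * (∫⁻ c : ℝ, ENNReal.ofReal ((1 + c ^ 2) ^ (-s))) *
      ∫⁻ x : Space d, ENNReal.ofReal (‖u x‖ ^ 2 * (1 + ‖x‖ ^ 2) ^ s) := by
  set e : Space d := EuclideanSpace.single i (1 : ℝ)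
  set h : Space d → ℝ≥0∞ := fun x => ENNReal.ofReal (‖u x‖ ^ 2 * (1 + ‖x‖ ^ 2) ^ s)
  set k : ℝ → ℝ≥0∞ := fun c => ENNReal.ofReal ((1 + c ^ 2) ^ (-s))
  have hu : Measurable fun x => ‖u x‖ := (Lp.stronglyMeasurable u).norm.measurable
  have hh : Measurable h := by fun_prop
  have hk : Measurable k := by fun_prop
  have hei : ∀ (c : ℝ) (x : Space d), (x + c • e) i = x i + c := by
    intro c x; simp [e]
  have hpt : ∀ (c : ℝ) (x : Space d), ENNReal.ofReal (‖u x‖ * ‖u (x + c • e)‖) ≤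
      h x * k (x i + c) + h (x + c • e) * k (x i) := by
    intro c x
    have := mul_le_weighted hs i _ _ (norm_nonneg (u x)) (norm_nonneg (u (x + c • e))) x (x + c • e)
    rw [hei] at this
    refine (ENNReal.ofReal_le_ofReal this).trans ?_
    rw [ENNReal.ofReal_add (by positivity) (by positivity), ENNReal.ofReal_mul (by positivity),
      ENNReal.ofReal_mul (q := (1 + x i ^ 2) ^ (-s)) (by positivity)]
  have m1 : Measurable fun z : ℝ × Space d => h z.2 * k (z.2 i + z.1) := by
    have : Measurable fun z : ℝ × Space d => z.2 i + z.1 :=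
      Continuous.measurable (by fun_prop)
    exact (hh.comp measurable_snd).mul (hk.comp this)
  have m2 : Measurable fun z : ℝ × Space d => h z.2 * k (z.2 i - z.1) := by
    have : Measurable fun z : ℝ × Space d => z.2 i - z.1 :=
      Continuous.measurable (by fun_prop)
    exact (hh.comp measurable_snd).mul (hk.comp this)
  have m1' : Measurable fun c : ℝ => ∫⁻ x, h x * k (x i + c) := m1.lintegral_prod_right'
  have i1 : ∫⁻ c : ℝ, ∫⁻ x, h x * k (x i + c) = (∫⁻ c, k c) * ∫⁻ x, h x := by
    rw [lintegral_lintegral_swap m1.aemeasurable]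
    calc _ = ∫⁻ x, h x * ∫⁻ c, k c := lintegral_congr fun x => by
          rw [lintegral_const_mul _ (by fun_prop), lintegral_add_left_eq_self k (x i)]
      _ = _ := by rw [lintegral_mul_const _ hh, mul_comm]
  have i2 : ∫⁻ c : ℝ, ∫⁻ x, h (x + c • e) * k (x i) = (∫⁻ c, k c) * ∫⁻ x, h x := by
    have : ∀ c : ℝ, ∫⁻ x, h (x + c • e) * k (x i) = ∫⁻ x, h x * k (x i - c) := by
      intro c
      rw [← lintegral_add_right_eq_self (fun x => h x * k (x i - c)) (c • e)]
      simp only [hei, add_sub_cancel_right]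
    simp_rw [this]
    rw [lintegral_lintegral_swap m2.aemeasurable]
    calc _ = ∫⁻ x, h x * ∫⁻ c, k c := lintegral_congr fun x => by
          rw [lintegral_const_mul _ (by fun_prop), lintegral_sub_left_eq_self k (x i)]
      _ = _ := by rw [lintegral_mul_const _ hh, mul_comm]
  calc _ ≤ ∫⁻ c : ℝ, ∫⁻ x, (h x * k (x i + c) + h (x + c • e) * k (x i)) :=
        lintegral_mono fun c => lintegral_mono fun x => hpt c x
    _ = ∫⁻ c : ℝ, ((∫⁻ x, h x * k (x i + c)) + ∫⁻ x, h (x + c • e) * k (x i)) := by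
        refine lintegral_congr fun c => lintegral_add_left ?_ _
        exact hh.mul (hk.comp (Continuous.measurable (by fun_prop)))
    _ = _ := by
        rw [lintegral_add_left m1', i1, i2]
        ring

/-! ### The integrated trace estimate in `L^{2,s}` -/

theorem integral_exp_mul_character {T : ℝ} (hT : 0 < T) (η : ℝ) :
    ∫ c : ℝ in Set.Ioi 0, ((T⁻¹ * Real.exp (-c / T) : ℝ) : ℂ) * exp ((η * c : ℝ) * I) =
      (1 - T * η * I)⁻¹ := by
  have hre : ((-T⁻¹ : ℝ) + η * I : ℂ).re < 0 := by simpa using hT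
  have h := integral_exp_mul_complex_Ioi hre 0
  have e : ∀ c : ℝ, ((T⁻¹ * Real.exp (-c / T) : ℝ) : ℂ) * exp ((η * c : ℝ) * I) =
      (T : ℂ)⁻¹ * exp (((-T⁻¹ : ℝ) + η * I : ℂ) * c) := by
    intro c
    push_cast
    rw [mul_assoc, ← Complex.exp_add]
    congr 2
    ring
  simp_rw [e]
  rw [integral_const_mul, h]
  have hT' : (T : ℂ) ≠ 0 := by exact_mod_cast hT.ne'
  have hne : ((-T⁻¹ : ℝ) + η * I : ℂ) ≠ 0 := fun h0 => by rw [h0] at hre; simp at hre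
  have hne' : (1 - T * η * I : ℂ) = -(T * ((-T⁻¹ : ℝ) + η * I)) := by
    push_cast
    field_simp
    ring
  rw [hne', ofReal_zero, mul_zero, Complex.exp_zero, inv_neg, mul_inv, neg_div, one_div, mul_neg]

theorem re_inv_one_sub_mul_I (r : ℝ) : ((1 - r * I : ℂ)⁻¹).re = (1 + r ^ 2)⁻¹ := by
  rw [Complex.inv_re, Complex.normSq_apply]
  simp [sq]

/-- The constant of the trace estimate in `L^{2,s}`. -/
noncomputable def traceConst (s : ℝ) : ℝ := ∫ c : ℝ, (1 + c ^ 2) ^ (-s)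

theorem traceConst_nonneg (s : ℝ) : 0 ≤ traceConst s :=
  integral_nonneg fun c => by positivity

/-- The threshold `s > 1/2` comes from here: the weight decays like `|c|^(-2s)` on the line. -/
theorem integrable_traceWeight {s : ℝ} (hs : 1 / 2 < s) :
    Integrable fun c : ℝ => (1 + c ^ 2) ^ (-s) := by
  have h := integrable_rpow_neg_one_add_norm_sq (E := ℝ) (μ := volume) (r := 2 * s)
    (by rw [Module.finrank_self]; push_cast; linarith)
  simpa [show -(2 * s) / 2 = -s by ring] using h

theorem normL2s_sq {s : ℝ} (u : L2 d) :
    normL2s s u ^ 2 = ∫ x : Space d, ‖u x‖ ^ 2 * (1 + ‖x‖ ^ 2) ^ s :=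
  Real.sq_sqrt (integral_nonneg fun x => by positivity)

theorem norm_le_normL2s {s : ℝ} (hs : 0 ≤ s) {u : L2 d} (hu : MemL2s s u) :
    ‖u‖ ≤ normL2s s u := by
  refine le_of_sq_le_sq ?_ (Real.sqrt_nonneg _)
  rw [normL2s_sq, norm_sq_eq_integral]
  refine integral_mono (integrable_norm_sq u) hu fun x => ?_
  exact le_mul_of_one_le_right (by positivity)
    (Real.one_le_rpow (le_add_of_nonneg_right (by positivity)) hs)

theorem lintegral_inner_translate_le {s : ℝ} (hs : 1 / 2 < s) (i : Fin d) {u : L2 d}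
    (hu : MemL2s s u) :
    ∫⁻ c : ℝ, ‖(inner ℂ u (translate (c • EuclideanSpace.single i (1 : ℝ)) u) : ℂ)‖ₑ ≤
      ENNReal.ofReal (2 * traceConst s * normL2s s u ^ 2) := by
  have h : ∀ c : ℝ, ‖(inner ℂ u (translate (c • EuclideanSpace.single i (1 : ℝ)) u) : ℂ)‖ₑ ≤
      ∫⁻ x : Space d,
        ENNReal.ofReal (‖u x‖ * ‖u (x + c • EuclideanSpace.single i (1 : ℝ))‖) := by
    intro c
    rw [L2.inner_def]
    refine (enorm_integral_le_lintegral_enorm _).trans (lintegral_mono_ae ?_)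
    filter_upwards [coeFn_translate (c • EuclideanSpace.single i (1 : ℝ)) u] with x hx
    rw [hx, ← ofReal_norm]
    exact ENNReal.ofReal_le_ofReal (norm_inner_le_norm _ _)
  refine (lintegral_mono h).trans ((lintegral_translate_le (by linarith) i u).trans (le_of_eq ?_))
  rw [← ofReal_integral_eq_lintegral_ofReal (integrable_traceWeight hs)
    (.of_forall fun c => by positivity), ← ofReal_integral_eq_lintegral_ofReal hu
    (.of_forall fun x => by positivity), ← normL2s_sq, ENNReal.ofReal_mul (by
      have := traceConst_nonneg s; positivity), ENNReal.ofReal_mul zero_le_two]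
  simp [traceConst]

/-- An integrated form of the trace theorem on hyperplanes: functions in the Fourier image of
`L^{2,s}` have little mass in thin slabs. -/
theorem integral_slab_le {s : ℝ} (hs : 1 / 2 < s) (i : Fin d) {u : L2 d} (hu : MemL2s s u)
    {T : ℝ} (hT : 0 < T) :
    ∫ ξ, ‖Lp.fourierTransformₗᵢ (Space d) ℂ u ξ‖ ^ 2 * (1 + (2 * Real.pi * T * ξ i) ^ 2)⁻¹ ≤
      T⁻¹ * (2 * traceConst s * normL2s s u ^ 2) := by
  set v := Lp.fourierTransformₗᵢ (Space d) ℂ u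
  set e : Space d := EuclideanSpace.single i (1 : ℝ)
  have hin : ∀ (c : ℝ) (ξ : Space d), 2 * Real.pi * inner ℝ (c • e) ξ = 2 * Real.pi * ξ i * c := by
    intro c ξ
    rw [real_inner_smul_left, EuclideanSpace.inner_single_left]
    simp
    ring
  have hexp : IntegrableOn (fun c : ℝ => T⁻¹ * Real.exp (-c / T)) (Set.Ioi 0) := by
    have := (integrableOn_exp_mul_Ioi (a := -T⁻¹) (by simpa using hT) 0).const_mul T⁻¹
    refine this.congr (.of_forall fun c => ?_)
    simp only
    congr 2
    ring
  have hint : Integrable (fun z : ℝ × Space d =>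
      ((T⁻¹ * Real.exp (-z.1 / T) : ℝ) : ℂ) * (exp ((2 * Real.pi * z.2 i * z.1 : ℝ) * I) *
        ((‖v z.2‖ ^ 2 : ℝ) : ℂ))) ((volume.restrict (Set.Ioi 0)).prod volume) := by
    have h1 := (hexp.ofReal (𝕜 := ℂ)).mul_prod ((integrable_norm_sq v).ofReal (𝕜 := ℂ))
    have h2 := h1.bdd_mul (c := 1) (f := fun z : ℝ × Space d =>
      exp ((2 * Real.pi * z.2 i * z.1 : ℝ) * I)) (Continuous.aestronglyMeasurable (by fun_prop))
      (.of_forall fun z => (norm_exp_ofReal_mul_I _).le)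
    refine h2.congr (.of_forall fun z => ?_)
    simp only [RCLike.ofReal_eq_complex_ofReal]
    ring
  -- Fubini, with the exponential integral in `c` computed for each frequency. The real part of the
  -- resulting factor is the slab weight.
  have hswap : ∫ c in Set.Ioi (0 : ℝ), ((T⁻¹ * Real.exp (-c / T) : ℝ) : ℂ) *
      inner ℂ u (translate (c • e) u) =
      ∫ ξ, ((‖v ξ‖ ^ 2 : ℝ) : ℂ) * (1 - (2 * Real.pi * T * ξ i : ℝ) * I)⁻¹ := by
    simp_rw [inner_translate, hin, ← integral_const_mul]
    rw [integral_integral_swap hint]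
    refine integral_congr_ae (.of_forall fun ξ => ?_)
    simp only
    simp_rw [← mul_assoc]
    rw [integral_mul_const, integral_exp_mul_character hT, mul_comm]
    congr 3
    push_cast
    ring
  have hbd : Integrable (fun ξ => ((‖v ξ‖ ^ 2 : ℝ) : ℂ) *
      (1 - (2 * Real.pi * T * ξ i : ℝ) * I)⁻¹) := by
    have hne : ∀ r : ℝ, (1 - r * I : ℂ) ≠ 0 := fun r h => by
      have := congrArg Complex.re h
      simp at this
    refine ((integrable_norm_sq v).ofReal (𝕜 := ℂ)).mul_bdd (c := 1)
      (Continuous.aestronglyMeasurable ?_) (.of_forall fun ξ => ?_)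
    · exact Continuous.inv₀ (by fun_prop) fun ξ => hne _
    · rw [norm_inv]
      refine inv_le_one_of_one_le₀ ?_
      have := Complex.abs_re_le_norm (1 - (2 * Real.pi * T * ξ i : ℝ) * I)
      simpa using this
  have hre : ∫ ξ, ‖v ξ‖ ^ 2 * (1 + (2 * Real.pi * T * ξ i) ^ 2)⁻¹ =
      (∫ c in Set.Ioi (0 : ℝ), ((T⁻¹ * Real.exp (-c / T) : ℝ) : ℂ) *
        inner ℂ u (translate (c • e) u)).re := by
    rw [hswap, ← RCLike.re_eq_complex_re, ← integral_re hbd]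
    refine integral_congr_ae (.of_forall fun ξ => ?_)
    simp only [RCLike.re_eq_complex_re]
    rw [Complex.re_ofReal_mul, re_inv_one_sub_mul_I]
  rw [hre]
  refine (Complex.re_le_norm _).trans ?_
  have hN : 0 ≤ 2 * traceConst s * normL2s s u ^ 2 := by
    have := traceConst_nonneg s; positivity
  -- Passing to extended nonnegative integrals needs no separate integrability proof. The kernel is
  -- then bounded by `T⁻¹` and the half-line enlarged to the whole line.
  rw [← ENNReal.ofReal_le_ofReal_iff (by positivity), ofReal_norm]
  calc _ ≤ ∫⁻ c in Set.Ioi (0 : ℝ), ‖((T⁻¹ * Real.exp (-c / T) : ℝ) : ℂ) *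
        inner ℂ u (translate (c • e) u)‖ₑ := enorm_integral_le_lintegral_enorm _
    _ ≤ ∫⁻ c in Set.Ioi (0 : ℝ), ENNReal.ofReal T⁻¹ * ‖inner ℂ u (translate (c • e) u)‖ₑ := by
        refine setLIntegral_mono_ae' measurableSet_Ioi (.of_forall fun c hc => ?_)
        rw [enorm_mul]
        gcongr
        rw [← ofReal_norm, Complex.norm_real, Real.norm_of_nonneg (by positivity)]
        refine ENNReal.ofReal_le_ofReal (mul_le_of_le_one_right (by positivity) ?_)
        exact Real.exp_le_one_iff.mpr (div_nonpos_of_nonpos_of_nonneg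
          (neg_nonpos.mpr (le_of_lt hc)) hT.le)
    _ ≤ ENNReal.ofReal T⁻¹ * ∫⁻ c : ℝ, ‖inner ℂ u (translate (c • e) u)‖ₑ := by
        rw [lintegral_const_mul' _ _ ENNReal.ofReal_ne_top]
        gcongr
        exact Measure.restrict_le_self
    _ ≤ _ := by
        rw [ENNReal.ofReal_mul (by positivity)]
        gcongr
        exact lintegral_inner_translate_le hs i hu

/-! ### Decay of time averages for the flow of `K` -/

/-- The averaged symbol `S` satisfies `S ≤ 1` trivially and `T freq ξ S ≤ 1` by oscillation. Adding
the squares gives `S² (1 + (T freq ξ)²) ≤ 2`, and `|ξ_i| ≤ |ξ|` weakens the weight to one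
coordinate. -/
theorem norm_integralSymbol_average_sq_le {T : ℝ} (hT : 0 < T) (i : Fin d) (ξ : Space d) :
    ‖((2 * T)⁻¹ : ℝ) • integralSymbol (-T) T ξ‖ ^ 2 ≤
      2 * (1 + (2 * Real.pi * T * ξ i) ^ 2)⁻¹ := by
  have h1 : ‖((2 * T)⁻¹ : ℝ) • integralSymbol (-T) T ξ‖ ≤ 1 := by
    rw [norm_smul, Real.norm_of_nonneg (by positivity), inv_mul_le_one₀ (by positivity)]
    refine (norm_integralSymbol_le _ _ ξ).trans_eq ?_
    rw [abs_of_pos (by linarith)]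
    ring
  have h2 : T * freq ξ * ‖((2 * T)⁻¹ : ℝ) • integralSymbol (-T) T ξ‖ ≤ 1 := by
    have hb : freq ξ * ‖integralSymbol (-T) T ξ‖ ≤ 2 := by
      have := congrArg norm (freq_mul_integralSymbol (-T) T ξ)
      rw [norm_mul, norm_mul, Complex.norm_real, Real.norm_of_nonneg (freq_nonneg ξ), norm_I,
        one_mul] at this
      rw [this]
      refine (norm_sub_le _ _).trans ?_
      rw [norm_exp_ofReal_mul_I, norm_exp_ofReal_mul_I]
      norm_num
    rw [norm_smul, Real.norm_of_nonneg (by positivity)]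
    calc _ = freq ξ * ‖integralSymbol (-T) T ξ‖ / 2 := by field_simp
      _ ≤ 1 := by linarith
  have h3 : (2 * Real.pi * T * ξ i) ^ 2 ≤ (T * freq ξ) ^ 2 := by
    have : |ξ i| ≤ ‖ξ‖ := by
      rw [← Real.norm_eq_abs]
      exact PiLp.norm_apply_le ξ i
    rw [sq_le_sq, abs_mul, abs_of_nonneg (by positivity : 0 ≤ 2 * Real.pi * T),
      abs_of_nonneg (mul_nonneg hT.le (freq_nonneg ξ))]
    calc _ ≤ 2 * Real.pi * T * ‖ξ‖ := by gcongr
      _ = _ := by unfold freq; ring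
  set S := ‖((2 * T)⁻¹ : ℝ) • integralSymbol (-T) T ξ‖
  have hS : 0 ≤ S := norm_nonneg _
  have hl := mul_nonneg hT.le (freq_nonneg ξ)
  rw [← div_eq_mul_inv, le_div_iff₀ (by positivity)]
  have h4 : S ^ 2 ≤ 1 := pow_le_one₀ hS h1
  have h5 : (T * freq ξ * S) ^ 2 ≤ 1 := pow_le_one₀ (mul_nonneg hl hS) h2
  nlinarith [sq_nonneg S]

theorem norm_timeAverage_le {X : Type*} [NormedAddCommGroup X] [NormedSpace ℝ X] {f : ℝ → X}
    {M : ℝ} (hf : ∀ t, ‖f t‖ ≤ M) (hM : 0 ≤ M) {T : ℝ} (hT : 0 ≤ T) : ‖timeAverage f T‖ ≤ M := by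
  have h := intervalIntegral.norm_integral_le_of_norm_le_const (a := -T) (b := T)
    (f := f) (C := M) (fun t _ => hf t)
  rw [timeAverage, norm_smul, Real.norm_of_nonneg (by positivity)]
  rcases hT.eq_or_lt with rfl | hT
  · simpa using hM
  rw [inv_mul_le_iff₀ (by positivity)]
  rw [abs_of_pos (by linarith)] at h
  linarith

theorem norm_halfWave (t : ℝ) (u : L2 d) : ‖halfWave d t u‖ = ‖u‖ := by
  have : ‖halfWave d t u‖ ^ 2 = ‖u‖ ^ 2 := by
    rw [norm_sq_eq_integral, norm_sq_eq_integral]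
    refine integral_congr_ae ?_
    filter_upwards [coeFn_halfWave t u] with ξ h
    rw [h, norm_mul, norm_exp_ofReal_mul_I, one_mul]
  exact (sq_eq_sq₀ (norm_nonneg _) (norm_nonneg _)).mp this

theorem norm_halfFlow (t : ℝ) (u : L2 d) : ‖halfFlow u t‖ = ‖u‖ := by
  rw [halfFlow, LinearIsometryEquiv.norm_map, norm_halfWave, LinearIsometryEquiv.norm_map]

/-- Norm conservation bounds the square of the average, and the slab estimate bounds `T` times that
square. Their sum controls `1 + T` times the square, so the bound stays finite as `T` tends to 0. -/
theorem norm_timeAverage_halfFlow_sq_le {s : ℝ} (hs : 1 / 2 < s) (i : Fin d) {u : L2 d}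
    (hu : MemL2s s u) {T : ℝ} (hT : 0 < T) :
    ‖timeAverage (halfFlow u) T‖ ^ 2 ≤
      (1 + 4 * traceConst s) * (1 + T)⁻¹ * normL2s s u ^ 2 := by
  have h1 : ‖timeAverage (halfFlow u) T‖ ^ 2 ≤ normL2s s u ^ 2 := by
    gcongr
    exact (norm_timeAverage_le (fun t => (norm_halfFlow t u).le) (norm_nonneg u) hT.le).trans
      (norm_le_normL2s (by linarith) hu)
  have h2 : ‖timeAverage (halfFlow u) T‖ ^ 2 ≤ 2 * (T⁻¹ * (2 * traceConst s * normL2s s u ^ 2)) := by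
    refine le_trans ?_ (mul_le_mul_of_nonneg_left (integral_slab_le hs i hu hT) zero_le_two)
    set U := Lp.fourierTransformₗᵢ (Space d) ℂ with hU
    have e : ‖timeAverage (halfFlow u) T‖ ^ 2 = ((2 * T)⁻¹) ^ 2 *
        ∫ ξ, ‖boundedMul (integralSymbol (-T) T) (memLp_integralSymbol (-T) T) (U u) ξ‖ ^ 2 := by
      rw [timeAverage, norm_smul, Real.norm_of_nonneg (by positivity), mul_pow, ← U.norm_map,
        hU, fourier_integral_halfFlow, norm_sq_eq_integral]
    rw [e, ← integral_const_mul, ← integral_const_mul]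
    refine integral_mono_ae ((integrable_norm_sq _).const_mul _) ?_ ?_
    · refine ((integrable_norm_sq (U u)).mul_bdd (c := 1) (Continuous.aestronglyMeasurable ?_)
        (.of_forall fun ξ => ?_)).const_mul 2
      · exact Continuous.inv₀ (by fun_prop) fun ξ => by positivity
      · rw [norm_inv, Real.norm_of_nonneg (by positivity)]
        exact inv_le_one_of_one_le₀ (le_add_of_nonneg_right (by positivity))
    · filter_upwards [coeFn_boundedMul _ (memLp_integralSymbol (-T) T) (U u)] with ξ h
      have hb := norm_integralSymbol_average_sq_le hT i ξ
      rw [norm_smul, Real.norm_of_nonneg (by positivity), mul_pow] at hb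
      rw [h, norm_mul, mul_pow, ← mul_assoc]
      calc _ ≤ 2 * (1 + (2 * Real.pi * T * ξ i) ^ 2)⁻¹ * ‖U u ξ‖ ^ 2 := by gcongr
        _ = _ := by ring
  have h3 : T * ‖timeAverage (halfFlow u) T‖ ^ 2 ≤ 4 * traceConst s * normL2s s u ^ 2 := by
    calc _ ≤ T * (2 * (T⁻¹ * (2 * traceConst s * normL2s s u ^ 2))) := by gcongr
      _ = _ := by field_simp; ring
  rw [mul_right_comm, ← div_eq_mul_inv, le_div_iff₀ (by positivity)]
  linarith

theorem timeAverage_comp_neg {X : Type*} [NormedAddCommGroup X] [NormedSpace ℝ X] (f : ℝ → X)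
    (T : ℝ) : timeAverage (fun t => f (-t)) T = timeAverage f T := by
  rw [timeAverage, timeAverage, intervalIntegral.integral_comp_neg, neg_neg]

/-- Decay of the time averages of the flow of `K`, uniformly in `T > 0`. -/
theorem IsFlowOfK.norm_timeAverage_le {s : ℝ} (hs : 1 / 2 < s) (i : Fin d) {F₀ : L2Sum d}
    {F : ℝ → L2Sum d} (hF : IsFlowOfK F₀ F) (h1 : MemL2s s F₀.fst) (h2 : MemL2s s F₀.snd)
    {T : ℝ} (hT : 0 < T) :
    ‖timeAverage F T‖ ≤ √(1 + 4 * traceConst s) * (1 + T) ^ (-(1 / 2) : ℝ) *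
      √(normL2s s F₀.fst ^ 2 + normL2s s F₀.snd ^ 2) := by
  have hi := hF.1.intervalIntegrable (μ := volume) (-T) T
  have hfst : (timeAverage F T).fst = timeAverage (halfFlow F₀.fst) T := by
    have := (WithLp.fstL 2 ℂ (L2 d) (L2 d)).intervalIntegral_comp_comm hi
    rw [hF.eq_halfFlow] at this ⊢
    exact congrArg ((2 * T)⁻¹ • ·) this.symm
  have hsnd : (timeAverage F T).snd = timeAverage (halfFlow F₀.snd) T := by
    have := (WithLp.sndL 2 ℂ (L2 d) (L2 d)).intervalIntegral_comp_comm hi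
    rw [hF.eq_halfFlow] at this ⊢
    -- The averaging window is symmetric, so the reversed time in the second component does not
    -- matter.
    rw [← timeAverage_comp_neg (halfFlow F₀.snd)]
    exact congrArg ((2 * T)⁻¹ • ·) this.symm
  have hk := traceConst_nonneg s
  have hsqrt : (1 + T) ^ (-(1 / 2) : ℝ) = √((1 + T)⁻¹) := by
    rw [Real.rpow_neg (by positivity), ← Real.sqrt_eq_rpow, Real.sqrt_inv]
  rw [hsqrt, ← Real.sqrt_mul (by positivity), ← Real.sqrt_mul (by positivity)]
  refine Real.le_sqrt_of_sq_le ?_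
  rw [WithLp.prod_norm_sq_eq_of_L2, hfst, hsnd, mul_add]
  exact add_le_add (norm_timeAverage_halfFlow_sq_le hs i h1 hT)
    (norm_timeAverage_halfFlow_sq_le hs i h2 hT)

/-! ### The wave equation in tempered distributions: existence -/

/-- Plancherel's theorem for the pairing of an `L²` function with a Schwartz function. -/
theorem toTemperedDistribution_apply_eq_fourier (u : L2 d) (φ : 𝓢(Space d, ℂ)) :
    (u : 𝓢'(Space d, ℂ)) φ =
      ∫ ξ, (𝓕⁻ φ : 𝓢(Space d, ℂ)) ξ * Lp.fourierTransformₗᵢ (Space d) ℂ u ξ := by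
  have h : (𝓕 (u : 𝓢'(Space d, ℂ)) : 𝓢'(Space d, ℂ)) (𝓕⁻ φ) = (u : 𝓢'(Space d, ℂ)) φ := by
    rw [TemperedDistribution.fourier_apply, FourierTransform.fourier_fourierInv_eq]
  rw [← h, Lp.fourier_toTemperedDistribution_eq, Lp.toTemperedDistribution_apply]
  rfl

/-- The multiplier formula is proved for `𝓕` and carried over by the reflection `ξ ↦ -ξ`, under
which `freq` is even. -/
theorem fourierInv_laplacian (φ : 𝓢(Space d, ℂ)) (ξ : Space d) :
    (𝓕⁻ (Δ φ) : 𝓢(Space d, ℂ)) ξ = -((freq ξ : ℂ) ^ 2 * (𝓕⁻ φ : 𝓢(Space d, ℂ)) ξ) := by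
  have h : ∀ η : Space d, (𝓕 (Δ φ) : 𝓢(Space d, ℂ)) η =
      -((freq η : ℂ) ^ 2 * (𝓕 φ : 𝓢(Space d, ℂ)) η) := by
    intro η
    have hg : Function.HasTemperateGrowth fun x : Space d => ‖x‖ ^ 2 := by fun_prop
    rw [SchwartzMap.laplacian_eq_fourierMultiplierCLM, SchwartzMap.fourierMultiplierCLM_apply,
      FourierTransform.fourier_smul, FourierTransform.fourier_fourierInv_eq]
    rw [_root_.smul_apply, SchwartzMap.smulLeftCLM_apply_apply hg, freq]
    simp only [real_smul]
    push_cast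
    ring
  have := h (-ξ)
  rw [SchwartzMap.fourierInv_apply_eq, SchwartzMap.fourierInv_apply_eq]
  simpa [freq] using this

theorem integrable_mul_L2 {ψ : Space d → ℂ} (hψ : MemLp ψ 2 volume) (u : L2 d) :
    Integrable fun ξ => ψ ξ * u ξ :=
  hψ.integrable_mul (Lp.memLp u)

theorem memLp_fourierInv (φ : 𝓢(Space d, ℂ)) : MemLp (𝓕⁻ φ : 𝓢(Space d, ℂ)) 2 volume :=
  (𝓕⁻ φ : 𝓢(Space d, ℂ)).memLp 2 volume

theorem memLp_freq_sq_mul_fourierInv (φ : 𝓢(Space d, ℂ)) :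
    MemLp (fun ξ => (freq ξ : ℂ) ^ 2 * (𝓕⁻ φ : 𝓢(Space d, ℂ)) ξ) 2 volume := by
  refine (memLp_fourierInv (Δ φ)).neg.congr_norm ?_ ?_
  · exact Continuous.aestronglyMeasurable (by fun_prop)
  · exact .of_forall fun ξ => by rw [Pi.neg_apply, fourierInv_laplacian, neg_neg]

/-- `freq` is not smooth at the origin, so this product need not be Schwartz. Membership in `L²`
follows from `freq ≤ 1 + freq²`. -/
theorem memLp_freq_mul_fourierInv (φ : 𝓢(Space d, ℂ)) :
    MemLp (fun ξ => (freq ξ : ℂ) * (𝓕⁻ φ : 𝓢(Space d, ℂ)) ξ) 2 volume := by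
  refine ((memLp_fourierInv φ).norm.add (memLp_freq_sq_mul_fourierInv φ).norm).of_le
    (Continuous.aestronglyMeasurable (by fun_prop)) (.of_forall fun ξ => ?_)
  have hf := freq_nonneg ξ
  simp only [Pi.add_apply, norm_mul, norm_pow, Complex.norm_real, Real.norm_of_nonneg hf]
  rw [Real.norm_of_nonneg (by positivity)]
  nlinarith [norm_nonneg ((𝓕⁻ φ : 𝓢(Space d, ℂ)) ξ), sq_nonneg (freq ξ - 1)]

/-- Since `|ξ|` is not smooth, it cannot multiply general tempered distributions. The factorisation
`freq = (1 + freq²) · freq / (1 + freq²)` defines `√(-Δ)` on `L²` as a bounded multiplier followed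
by `1 - Δ`. -/
theorem memLp_boundedSymbol :
    MemLp (fun ξ : Space d => ((freq ξ / (1 + freq ξ ^ 2) : ℝ) : ℂ)) ∞ volume := by
  refine memLp_top_of_bound (Continuous.aestronglyMeasurable ?_) 1 (.of_forall fun ξ => ?_)
  · exact continuous_ofReal.comp (continuous_freq.div (by fun_prop) fun ξ => by positivity)
  · have hf := freq_nonneg ξ
    rw [Complex.norm_real, Real.norm_of_nonneg (by positivity), div_le_one (by positivity)]
    nlinarith [sq_nonneg (freq ξ - 1)]

/-- The operator `√(-Δ)` from `L²(ℝ^d)` to the tempered distributions. -/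
noncomputable def sqrtHDist (d : ℕ) : L2 d →ₗ[ℂ] 𝓢'(Space d, ℂ) :=
  (LinearMap.id - (LineDeriv.laplacianCLM ℂ (Space d) 𝓢'(Space d, ℂ)).toLinearMap) ∘ₗ
    (Lp.toTemperedDistributionCLM ℂ (volume : Measure (Space d)) 2).toLinearMap ∘ₗ
    (Lp.fourierTransformₗᵢ (Space d) ℂ).symm.toLinearEquiv.toLinearMap ∘ₗ
    (boundedMul _ memLp_boundedSymbol).toLinearMap ∘ₗ
    (Lp.fourierTransformₗᵢ (Space d) ℂ).toLinearEquiv.toLinearMap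

theorem sqrtHDist_apply (u : L2 d) (φ : 𝓢(Space d, ℂ)) :
    sqrtHDist d u φ = ∫ ξ, (freq ξ * (𝓕⁻ φ : 𝓢(Space d, ℂ)) ξ) *
      Lp.fourierTransformₗᵢ (Space d) ℂ u ξ := by
  set U := Lp.fourierTransformₗᵢ (Space d) ℂ with hU
  set w : L2 d := U.symm (boundedMul _ memLp_boundedSymbol (U u)) with hw
  have e : sqrtHDist d u φ = (w : 𝓢'(Space d, ℂ)) φ - (w : 𝓢'(Space d, ℂ)) (Δ φ) := by
    have : sqrtHDist d u = (w : 𝓢'(Space d, ℂ)) - Δ (w : 𝓢'(Space d, ℂ)) := by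
      rw [← TemperedDistribution.laplacianCLM_apply]
      rfl
    rw [this, ← TemperedDistribution.laplacian_apply_apply]
    rfl
  rw [e, toTemperedDistribution_apply_eq_fourier, toTemperedDistribution_apply_eq_fourier,
    ← integral_sub (integrable_mul_L2 (memLp_fourierInv _) _)
      (integrable_mul_L2 (memLp_fourierInv _) _), ← hU, hw, U.apply_symm_apply]
  refine integral_congr_ae ?_
  filter_upwards [coeFn_boundedMul _ memLp_boundedSymbol (U u)] with ξ h
  rw [h, fourierInv_laplacian]
  have hne : (1 + (freq ξ : ℂ) ^ 2) ≠ 0 := by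
    exact_mod_cast (by positivity : (1 + freq ξ ^ 2) ≠ 0)
  push_cast
  field_simp
  ring

theorem IsInvSqrtH.eq_sqrtHDist {g : 𝓢'(Space d, ℂ)} {h : L2 d} (hg : IsInvSqrtH g h) :
    g = sqrtHDist d h := by
  ext φ
  have := hg (𝓕⁻ φ)
  rw [TemperedDistribution.fourier_apply, FourierTransform.fourier_fourierInv_eq] at this
  rw [this, sqrtHDist_apply]
  refine integral_congr_ae (.of_forall fun ξ => ?_)
  simp only [freq, mul_assoc, mul_left_comm]
  rfl

/-- The factor `freq` produced by differentiation is carried by the test function, so `u` needs no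
regularity; `|freq ψ u|` is an integrable bound uniform in time. -/
theorem hasDerivAt_integral_halfWave {ψ : Space d → ℂ} (hψ : MemLp ψ 2 volume)
    (hψ' : MemLp (fun ξ => (freq ξ : ℂ) * ψ ξ) 2 volume) (u : L2 d) (t : ℝ) :
    HasDerivAt (fun τ : ℝ => ∫ ξ, ψ ξ * halfWave d τ u ξ)
      (-I * ∫ ξ, (freq ξ * ψ ξ) * halfWave d t u ξ) t := by
  have e : ∀ (χ : Space d → ℂ) (τ : ℝ), ∫ ξ, χ ξ * halfWave d τ u ξ =
      ∫ ξ, exp ((-(τ * freq ξ) : ℝ) * I) * (χ ξ * u ξ) := by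
    intro χ τ
    refine integral_congr_ae ?_
    filter_upwards [coeFn_halfWave τ u] with ξ h
    rw [h, mul_left_comm]
  rw [funext (e ψ), e (fun ξ => freq ξ * ψ ξ), ← integral_const_mul]
  have hm : ∀ τ : ℝ, AEStronglyMeasurable (fun ξ : Space d => exp ((-(τ * freq ξ) : ℝ) * I))
    volume := fun τ => Continuous.aestronglyMeasurable (by fun_prop)
  have i0 := integrable_mul_L2 hψ u
  have i1 := integrable_mul_L2 hψ' u
  refine (hasDerivAt_integral_of_dominated_loc_of_deriv_le (μ := volume)
    (F' := fun (τ : ℝ) (ξ : Space d) => -I * (exp ((-(τ * freq ξ) : ℝ) * I) *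
      (freq ξ * ψ ξ * u ξ)))
    (bound := fun ξ => ‖freq ξ * ψ ξ * u ξ‖) univ_mem ?_ ?_ ?_ ?_ i1.norm ?_).2
  · exact .of_forall fun τ => (hm τ).mul i0.1
  · exact i0.bdd_mul (hm t) (.of_forall fun ξ => (norm_exp_ofReal_mul_I _).le)
  · exact ((hm t).mul i1.1).const_mul _
  · refine .of_forall fun ξ τ _ => ?_
    rw [norm_mul, norm_mul, norm_neg, norm_I, norm_exp_ofReal_mul_I, one_mul, one_mul]
  · refine .of_forall fun ξ τ _ => ?_
    have h1 : HasDerivAt (fun τ : ℝ => ((-(τ * freq ξ) : ℝ) : ℂ) * I)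
        (((-(1 * freq ξ) : ℝ) : ℂ) * I) τ :=
      (((hasDerivAt_id τ).mul_const (freq ξ)).neg.ofReal_comp).mul_const I
    refine (h1.cexp.mul_const _).congr_deriv ?_
    push_cast
    ring

theorem fourier_halfFlow (u : L2 d) (t : ℝ) : Lp.fourierTransformₗᵢ (Space d) ℂ (halfFlow u t) =
    halfWave d t (Lp.fourierTransformₗᵢ (Space d) ℂ u) :=
  (Lp.fourierTransformₗᵢ (Space d) ℂ).apply_symm_apply _

theorem hasDerivAt_halfFlow_apply (u : L2 d) (φ : 𝓢(Space d, ℂ)) (t : ℝ) :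
    HasDerivAt (fun τ : ℝ => (halfFlow u τ : 𝓢'(Space d, ℂ)) φ)
      (-I * sqrtHDist d (halfFlow u t) φ) t := by
  simp_rw [toTemperedDistribution_apply_eq_fourier, sqrtHDist_apply, fourier_halfFlow]
  exact hasDerivAt_integral_halfWave (memLp_fourierInv φ) (memLp_freq_mul_fourierInv φ) _ t

theorem hasDerivAt_sqrtHDist_halfFlow_apply (u : L2 d) (φ : 𝓢(Space d, ℂ)) (t : ℝ) :
    HasDerivAt (fun τ : ℝ => sqrtHDist d (halfFlow u τ) φ)
      (I * (Δ (halfFlow u t : 𝓢'(Space d, ℂ))) φ) t := by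
  rw [TemperedDistribution.laplacian_apply_apply]
  simp_rw [toTemperedDistribution_apply_eq_fourier, sqrtHDist_apply, fourier_halfFlow]
  have h2 : MemLp (fun ξ => (freq ξ : ℂ) * (freq ξ * (𝓕⁻ φ : 𝓢(Space d, ℂ)) ξ)) 2 volume := by
    refine (memLp_congr_ae (.of_forall fun ξ => ?_)).1 (memLp_freq_sq_mul_fourierInv φ)
    ring
  refine (hasDerivAt_integral_halfWave (memLp_freq_mul_fourierInv φ) h2 _ t).congr_deriv ?_
  rw [neg_mul, ← mul_neg, ← integral_neg]
  congr 1
  refine integral_congr_ae (.of_forall fun ξ => ?_)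
  simp only [fourierInv_laplacian]
  ring

theorem isWaveSolution_halfFlow {g₀ : 𝓢'(Space d, ℂ)} {f₀ h₀ a b : L2 d} (hg : IsInvSqrtH g₀ h₀)
    (hf : a + b = f₀) (hh : a - b = I • h₀) :
    IsWaveSolution f₀ g₀ (fun t => halfFlow a t + halfFlow b (-t)) := by
  have h0 : ∀ u : L2 d, halfFlow u 0 = u := fun u => by
    rw [halfFlow, halfWave_zero, LinearIsometryEquiv.symm_apply_apply]
  refine ⟨(continuous_halfFlow a).add ((continuous_halfFlow b).comp continuous_neg), ?_,
    -- The velocity is `√H` applied to `-i` times the forward wave plus `i` times the backward one.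
    -- At time 0 this is `√H(-i(a - b)) = √H h₀ = g₀`.
    fun t => sqrtHDist d (-I • halfFlow a t + I • halfFlow b (-t)), ?_, fun φ t => ?_⟩
  · simp only [neg_zero, h0, hf]
  · simp only [neg_zero, h0]
    rw [hg.eq_sqrtHDist]
    congr 1
    rw [neg_smul, neg_add_eq_sub, ← smul_sub, ← neg_sub a b, hh, smul_neg, smul_smul, I_mul_I]
    simp
  · have hn := hasDerivAt_neg t
    have e1 : ∀ u v : L2 d, ((u + v : L2 d) : 𝓢'(Space d, ℂ)) φ =
        (u : 𝓢'(Space d, ℂ)) φ + (v : 𝓢'(Space d, ℂ)) φ := by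
      intro u v
      simp only [← Lp.toTemperedDistributionCLM_apply, map_add]
      rfl
    have e2 : ∀ u v : L2 d, sqrtHDist d (-I • u + I • v) φ =
        -I * sqrtHDist d u φ + I * sqrtHDist d v φ := by
      intro u v
      rw [map_add, map_smul, map_smul]
      rfl
    have e3 : ∀ u v : L2 d, (Δ ((u + v : L2 d) : 𝓢'(Space d, ℂ))) φ =
        (Δ (u : 𝓢'(Space d, ℂ))) φ + (Δ (v : 𝓢'(Space d, ℂ))) φ := by
      intro u v
      simp only [← Lp.toTemperedDistributionCLM_apply, map_add,
        TemperedDistribution.laplacian_apply_apply]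
      rfl
    simp only [e1, e2, e3]
    constructor
    · have h1 := hasDerivAt_halfFlow_apply a φ t
      have h2 := (hasDerivAt_halfFlow_apply b φ (-t)).scomp t hn
      refine (h1.add h2).congr_deriv ?_
      rw [neg_one_smul]
      ring
    · have h1 := (hasDerivAt_sqrtHDist_halfFlow_apply a φ t).const_mul (-I)
      have h2 := ((hasDerivAt_sqrtHDist_halfFlow_apply b φ (-t)).scomp t hn).const_mul I
      refine (h1.add h2).congr_deriv ?_
      rw [neg_one_smul]
      linear_combination (-(Δ (halfFlow a t : 𝓢'(Space d, ℂ))) φ -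
        (Δ (halfFlow b (-t) : 𝓢'(Space d, ℂ))) φ) * I_mul_I

/-! ### The wave equation in tempered distributions: uniqueness -/

theorem ae_eq_of_integral_schwartz {a b : Space d → ℂ} (ha : LocallyIntegrable a)
    (hb : LocallyIntegrable b) (h : ∀ ψ : 𝓢(Space d, ℂ), ∫ ξ, ψ ξ * a ξ = ∫ ξ, ψ ξ * b ξ) :
    a =ᵐ[volume] b := by
  refine ae_eq_of_integral_contDiff_smul_eq ha hb fun g hg hc => ?_
  have h1 : HasCompactSupport (Complex.ofRealCLM ∘ g) := hc.comp_left rfl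
  have h2 : ContDiff ℝ ((⊤ : ℕ∞) : WithTop ℕ∞) (Complex.ofRealCLM ∘ g) := by fun_prop
  simpa using h (h1.toSchwartzMap h2)

/-- The pairing of `L²` functions with a fixed Schwartz function. -/
noncomputable def pairSchwartz (φ : 𝓢(Space d, ℂ)) : L2 d →L[ℂ] ℂ :=
  (PointwiseConvergenceCLM.evalCLM (RingHom.id ℂ) ℂ φ).comp
    (Lp.toTemperedDistributionCLM ℂ (volume : Measure (Space d)) 2)

theorem pairSchwartz_apply (φ : 𝓢(Space d, ℂ)) (u : L2 d) :
    pairSchwartz φ u = (u : 𝓢'(Space d, ℂ)) φ := rfl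

/-- If the distributional Laplacian of `w` is an `L²` function `u`, the relation becomes pointwise
on the Fourier side, so that `freq² ŵ` is in `L²`. -/
theorem fourier_ae_eq_of_laplacian {u w : L2 d}
    (h : ∀ φ : 𝓢(Space d, ℂ), (u : 𝓢'(Space d, ℂ)) φ = (w : 𝓢'(Space d, ℂ)) (Δ φ)) :
    Lp.fourierTransformₗᵢ (Space d) ℂ u =ᵐ[volume]
      fun ξ => -((freq ξ : ℂ) ^ 2 * Lp.fourierTransformₗᵢ (Space d) ℂ w ξ) := by
  have hl : ∀ v : L2 d, LocallyIntegrable v := fun v => (Lp.memLp v).locallyIntegrable one_le_two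
  refine ae_eq_of_integral_schwartz (hl _) ?_ fun ψ => ?_
  · refine LocallyIntegrable.neg ?_
    rw [locallyIntegrable_iff]
    intro k hk
    exact ((hl _).integrableOn_isCompact hk).continuousOn_mul
      (Continuous.continuousOn (by fun_prop)) hk
  · have := h (𝓕 ψ)
    rw [toTemperedDistribution_apply_eq_fourier, toTemperedDistribution_apply_eq_fourier] at this
    simp only [fourierInv_laplacian, FourierTransform.fourierInv_fourier_eq] at this
    rw [this]
    refine integral_congr_ae (.of_forall fun ξ => ?_)
    simp only
    ring

/-- The difference `g` of two solutions is merely continuous in `L²`. Its second primitive `W`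
satisfies `W'' = g = ΔW`, where `W''` is a genuine `L²` derivative, so `eq_zero_of_energy` applies
and yields `g = W'' = 0`. -/
theorem IsWaveSolution.unique {f₀ : L2 d} {g₀ : 𝓢'(Space d, ℂ)} {f f' : ℝ → L2 d}
    (hf : IsWaveSolution f₀ g₀ f) (hf' : IsWaveSolution f₀ g₀ f') : f = f' := by
  obtain ⟨hc, h0, v, hv0, hv⟩ := hf
  obtain ⟨hc', h0', v', hv0', hv'⟩ := hf'
  set g : ℝ → L2 d := fun t => f t - f' t with hg
  have hgc : Continuous g := hc.sub hc'
  set W₁ : ℝ → L2 d := fun t => ∫ τ in (0 : ℝ)..t, g τ with hW₁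
  have dW₁ : ∀ t, HasDerivAt W₁ (g t) t := fun t =>
    (hgc.integral_hasStrictDerivAt 0 t).hasDerivAt
  have cW₁ : Continuous W₁ := continuous_iff_continuousAt.mpr fun t => (dW₁ t).continuousAt
  set W : ℝ → L2 d := fun t => ∫ τ in (0 : ℝ)..t, W₁ τ with hW
  have dW : ∀ t, HasDerivAt W (W₁ t) t := fun t =>
    (cW₁.integral_hasStrictDerivAt 0 t).hasDerivAt
  have W₁0 : W₁ 0 = 0 := by simp [hW₁]
  have W0 : W 0 = 0 := by simp [hW]
  have key : ∀ (φ : 𝓢(Space d, ℂ)) (t : ℝ),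
      (g t : 𝓢'(Space d, ℂ)) φ = (W t : 𝓢'(Space d, ℂ)) (Δ φ) := by
    intro φ
    have hL : ∀ {y : ℝ → L2 d} {y' : L2 d} {t : ℝ}, HasDerivAt y y' t →
        HasDerivAt (fun t => pairSchwartz (Δ φ) (y t)) (pairSchwartz (Δ φ) y') t := fun h =>
      ((pairSchwartz (Δ φ)).restrictScalars ℝ).hasFDerivAt.comp_hasDerivAt _ h
    have hsub : ∀ t, (Δ (f t : 𝓢'(Space d, ℂ))) φ - (Δ (f' t : 𝓢'(Space d, ℂ))) φ =
        pairSchwartz (Δ φ) (g t) := by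
      intro t
      rw [TemperedDistribution.laplacian_apply_apply, TemperedDistribution.laplacian_apply_apply,
        ← pairSchwartz_apply, ← pairSchwartz_apply, ← map_sub]
    -- The equation is integrated in time twice against a fixed test function; zero initial data
    -- remove both constants.
    have d1 : ∀ t, HasDerivAt (fun t => v t φ - v' t φ - pairSchwartz (Δ φ) (W₁ t)) 0 t := by
      intro t
      refine (((hv φ t).2.sub (hv' φ t).2).sub (hL (dW₁ t))).congr_deriv ?_
      rw [hsub, sub_self]
    have z1 : ∀ t, v t φ - v' t φ - pairSchwartz (Δ φ) (W₁ t) = 0 := by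
      intro t
      have := is_const_of_deriv_eq_zero (fun t => (d1 t).differentiableAt)
        (fun t => (d1 t).deriv) t 0
      simpa [hv0, hv0', W₁0] using this
    have d2 : ∀ t, HasDerivAt (fun t => (f t : 𝓢'(Space d, ℂ)) φ - (f' t : 𝓢'(Space d, ℂ)) φ -
        pairSchwartz (Δ φ) (W t)) 0 t := by
      intro t
      refine (((hv φ t).1.sub (hv' φ t).1).sub (hL (dW t))).congr_deriv (z1 t)
    intro t
    have := is_const_of_deriv_eq_zero (fun t => (d2 t).differentiableAt)
      (fun t => (d2 t).deriv) t 0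
    simp only [h0, h0', W0, map_zero, sub_self] at this
    rw [← pairSchwartz_apply, ← pairSchwartz_apply, ← sub_eq_zero, ← this, hg, map_sub]
    rfl
  have hF := fun t => fourier_ae_eq_of_laplacian fun φ => key φ t
  -- This formula supplies both hypotheses of the energy argument: it is Hermitian in `s` and `t`,
  -- and nonpositive for `s = t`.
  have hin : ∀ s t, inner ℂ (W s) (g t) = -∫ ξ, (freq ξ : ℂ) ^ 2 *
      inner ℂ (Lp.fourierTransformₗᵢ (Space d) ℂ (W s) ξ)
        (Lp.fourierTransformₗᵢ (Space d) ℂ (W t) ξ) := by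
    intro s t
    rw [← (Lp.fourierTransformₗᵢ (Space d) ℂ).inner_map_map, L2.inner_def, ← integral_neg]
    refine integral_congr_ae ?_
    filter_upwards [hF t] with ξ h
    rw [h, inner_neg_right, ← smul_eq_mul, inner_smul_right]
  have hz := eq_zero_of_energy dW dW₁ hgc W0 W₁0 (fun s t => ?_) (fun t => ?_)
  · funext t
    exact sub_eq_zero.mp (hz t)
  · rw [← inner_conj_symm (g s), hin, hin, map_neg, ← integral_conj]
    congr 1
    refine integral_congr_ae (.of_forall fun ξ => ?_)
    simp only [map_mul, map_pow, conj_ofReal, inner_conj_symm]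
  · rw [hin, Complex.neg_re, neg_nonpos]
    have : ∀ ξ : Space d, (freq ξ : ℂ) ^ 2 *
        inner ℂ (Lp.fourierTransformₗᵢ (Space d) ℂ (W t) ξ)
          (Lp.fourierTransformₗᵢ (Space d) ℂ (W t) ξ) =
        ((freq ξ ^ 2 * ‖Lp.fourierTransformₗᵢ (Space d) ℂ (W t) ξ‖ ^ 2 : ℝ) : ℂ) := by
      intro ξ
      rw [inner_self_eq_norm_sq_to_K, ofReal_mul, ofReal_pow, ofReal_pow]
      rfl
    simp_rw [this]
    rw [integral_complex_ofReal, Complex.ofReal_re]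
    exact integral_nonneg fun ξ => by positivity

/-! ### Time averages of waves and integrability in `T` -/

theorem normL2s_nonneg (s : ℝ) (u : L2 d) : 0 ≤ normL2s s u := Real.sqrt_nonneg _

/-- Used with `c = i` and `c = -i` for the two components of `F₀`: the two bounds add up to the sum
of the squared norms of `f₀` and `h₀`. -/
theorem memL2s_half_add {s : ℝ} {u v : L2 d} (hu : MemL2s s u) (hv : MemL2s s v) {c : ℂ}
    (hc : ‖c‖ = 1) :
    MemL2s s ((1 / 2 : ℂ) • (u + c • v)) ∧
      normL2s s ((1 / 2 : ℂ) • (u + c • v)) ^ 2 ≤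
        (1 / 2) * (normL2s s u ^ 2 + normL2s s v ^ 2) := by
  set w : L2 d := (1 / 2 : ℂ) • (u + c • v) with hw
  have hpt : ∀ᵐ x : Space d, ‖w x‖ ^ 2 * (1 + ‖x‖ ^ 2) ^ s ≤
      (1 / 2) * (‖u x‖ ^ 2 * (1 + ‖x‖ ^ 2) ^ s + ‖v x‖ ^ 2 * (1 + ‖x‖ ^ 2) ^ s) := by
    filter_upwards [Lp.coeFn_smul (1 / 2 : ℂ) (u + c • v), Lp.coeFn_add u (c • v),
      Lp.coeFn_smul c v] with x h1 h2 h3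
    have hn : ‖w x‖ ≤ (1 / 2) * (‖u x‖ + ‖v x‖) := by
      rw [hw, h1, Pi.smul_apply, h2, Pi.add_apply, h3, Pi.smul_apply, norm_smul]
      have := norm_add_le (u x) (c • v x)
      rw [norm_smul, hc, one_mul] at this
      simpa using this
    have hsq : ‖w x‖ ^ 2 ≤ (1 / 2) * (‖u x‖ ^ 2 + ‖v x‖ ^ 2) := by
      have := pow_le_pow_left₀ (norm_nonneg (w x)) hn 2
      nlinarith [sq_nonneg (‖u x‖ - ‖v x‖)]
    have hp : 0 ≤ (1 + ‖x‖ ^ 2) ^ s := by positivity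
    nlinarith [mul_le_mul_of_nonneg_right hsq hp]
  have hi : Integrable fun x : Space d =>
      (1 / 2) * (‖u x‖ ^ 2 * (1 + ‖x‖ ^ 2) ^ s + ‖v x‖ ^ 2 * (1 + ‖x‖ ^ 2) ^ s) :=
    (Integrable.add hu hv).const_mul _
  have hm : MemL2s s w := by
    refine hi.mono' ?_ ?_
    · have hwt : Continuous fun x : Space d => (1 + ‖x‖ ^ 2) ^ s :=
        Continuous.rpow_const (by fun_prop) fun x => Or.inl (by positivity)
      exact ((Lp.aestronglyMeasurable w).norm.pow 2).mul hwt.aestronglyMeasurable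
    · filter_upwards [hpt] with x hx
      rwa [Real.norm_of_nonneg (by positivity)]
  refine ⟨hm, ?_⟩
  rw [normL2s_sq, normL2s_sq, normL2s_sq, ← integral_add hu hv, ← integral_const_mul]
  exact integral_mono_ae hm hi hpt

/-- The solution of the wave equation in terms of the group `exp(-it√(-Δ))`. -/
theorem IsInvSqrtH.isWaveSolution {g₀ : 𝓢'(Space d, ℂ)} {f₀ h₀ : L2 d} (hg : IsInvSqrtH g₀ h₀) :
    IsWaveSolution f₀ g₀ (fun t => halfFlow ((1 / 2 : ℂ) • (f₀ + I • h₀)) t +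
      halfFlow ((1 / 2 : ℂ) • (f₀ - I • h₀)) (-t)) := by
  refine isWaveSolution_halfFlow hg ?_ ?_
  · module
  · module

theorem IsWaveSolution.eq_flow {g₀ : 𝓢'(Space d, ℂ)} {f₀ h₀ : L2 d} (hg : IsInvSqrtH g₀ h₀)
    {f : ℝ → L2 d} (hf : IsWaveSolution f₀ g₀ f) {F : ℝ → L2Sum d}
    (hF : IsFlowOfK (WithLp.toLp 2
      ((1 / 2 : ℂ) • (f₀ + I • h₀), (1 / 2 : ℂ) • (f₀ - I • h₀))) F) (t : ℝ) :
    f t = (F t).fst + (F t).snd := by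
  rw [hF.eq_halfFlow, hf.unique hg.isWaveSolution]
  rfl

/-- Decay of the time averages of the solutions of the wave equation, uniformly in `T > 0`. -/
theorem IsWaveSolution.norm_timeAverage_le {s : ℝ} (hs : 1 / 2 < s) (i : Fin d)
    {g₀ : 𝓢'(Space d, ℂ)} {f₀ h₀ : L2 d} (hg : IsInvSqrtH g₀ h₀) (h1 : MemL2s s f₀)
    (h2 : MemL2s s h₀) {f : ℝ → L2 d} (hf : IsWaveSolution f₀ g₀ f) {T : ℝ} (hT : 0 < T) :
    ‖timeAverage f T‖ ≤ 2 * √(1 + 4 * traceConst s) * (1 + T) ^ (-(1 / 2) : ℝ) *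
      (normL2s s f₀ + normL2s s h₀) := by
  obtain ⟨F, hF, -⟩ := existsUnique_isFlowOfK (WithLp.toLp 2
    ((1 / 2 : ℂ) • (f₀ + I • h₀), (1 / 2 : ℂ) • (f₀ - I • h₀)))
  have hi := hF.1.intervalIntegrable (μ := volume) (-T) T
  have e : timeAverage f T = (WithLp.fstL 2 ℂ (L2 d) (L2 d) + WithLp.sndL 2 ℂ (L2 d) (L2 d))
      (timeAverage F T) := by
    have := (WithLp.fstL 2 ℂ (L2 d) (L2 d) + WithLp.sndL 2 ℂ (L2 d) (L2 d)
      ).intervalIntegral_comp_comm hi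
    rw [timeAverage, timeAverage, ContinuousLinearMap.map_smul_of_tower, ← this]
    congr 1
    exact intervalIntegral.integral_congr fun t _ => hf.eq_flow hg hF t
  -- The factor 2 comes from bounding each component of the average of `F` by the norm of the pair.
  have hle : ‖timeAverage f T‖ ≤ 2 * ‖timeAverage F T‖ := by
    rw [e, two_mul]
    exact (norm_add_le _ _).trans (add_le_add (WithLp.norm_fst_le _ _) (WithLp.norm_snd_le _ _))
  obtain ⟨m1, n1⟩ := memL2s_half_add h1 h2 norm_I
  obtain ⟨m2, n2⟩ := memL2s_half_add h1 h2 (c := -I) (by rw [norm_neg, norm_I])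
  rw [neg_smul, ← sub_eq_add_neg] at m2 n2
  have hb := hF.norm_timeAverage_le hs i m1 m2 hT
  have hN : √(normL2s s ((1 / 2 : ℂ) • (f₀ + I • h₀)) ^ 2 +
      normL2s s ((1 / 2 : ℂ) • (f₀ - I • h₀)) ^ 2) ≤ normL2s s f₀ + normL2s s h₀ := by
    have p1 := normL2s_nonneg s f₀
    have p2 := normL2s_nonneg s h₀
    rw [Real.sqrt_le_left (by positivity)]
    nlinarith [mul_nonneg p1 p2]
  calc _ ≤ 2 * ‖timeAverage F T‖ := hle
    _ ≤ 2 * (√(1 + 4 * traceConst s) * (1 + T) ^ (-(1 / 2) : ℝ) *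
        (normL2s s f₀ + normL2s s h₀)) := by
        gcongr
        exact hb.trans (mul_le_mul_of_nonneg_left hN (by positivity))
    _ = _ := by ring

/-- The rate already obtained is the endpoint `ℓ = 1`; for `T > 1` it is stronger than any rate with
`ℓ < 1`. -/
theorem one_add_rpow_le {ℓ T : ℝ} (hℓ : ℓ < 1) (hT : 1 < T) :
    (1 + T) ^ (-(1 / 2) : ℝ) ≤ T ^ (-(ℓ / 2)) :=
  (Real.rpow_le_rpow_of_nonpos (by linarith) (by linarith) (by norm_num)).trans
    (Real.rpow_le_rpow_of_exponent_le hT.le (by linarith))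

/-- For finite `q` the `q`-th power decays like `|T|^(-q/2)`, which is integrable at infinity
because `q > 2`. -/
theorem memLp_decay {q : ℝ≥0∞} (hq : 2 < q) :
    MemLp (fun T : ℝ => (1 + ‖T‖) ^ (-(1 / 2) : ℝ)) q volume := by
  have hc : Continuous fun T : ℝ => (1 + ‖T‖) ^ (-(1 / 2) : ℝ) :=
    Continuous.rpow_const (by fun_prop) fun T => Or.inl (by positivity)
  rcases eq_or_ne q ∞ with rfl | hq'
  · refine memLp_top_of_bound hc.aestronglyMeasurable 1 (.of_forall fun T => ?_)
    rw [Real.norm_of_nonneg (by positivity)]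
    exact Real.rpow_le_one_of_one_le_of_nonpos (le_add_of_nonneg_right (norm_nonneg T))
      (by norm_num)
  · have h2 : 2 < q.toReal := by
      have := (ENNReal.toReal_lt_toReal ENNReal.ofNat_ne_top hq').mpr hq
      simpa using this
    rw [← integrable_norm_rpow_iff hc.aestronglyMeasurable (ne_bot_of_gt hq) hq']
    have := integrable_one_add_norm (E := ℝ) (μ := volume) (r := q.toReal / 2)
      (by rw [Module.finrank_self]; push_cast; linarith)
    refine this.congr (.of_forall fun T => ?_)
    simp only
    rw [Real.norm_of_nonneg (by positivity : 0 ≤ (1 + ‖T‖) ^ (-(1 / 2) : ℝ)), ← Real.rpow_mul (by positivity)]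
    congr 1
    ring

/-- The integral is continuous in `T`, but the prefactor `(2T)⁻¹` jumps at 0, so only measurability
is claimed. -/
theorem aestronglyMeasurable_timeAverage {X : Type*} [NormedAddCommGroup X] [NormedSpace ℝ X]
    {f : ℝ → X} (hf : Continuous f) (μ : Measure ℝ) :
    AEStronglyMeasurable (timeAverage f) μ := by
  have hp := intervalIntegral.continuous_primitive (μ := volume)
    (fun a b => hf.intervalIntegrable a b) 0
  have hc : Continuous fun T : ℝ => ∫ t in (-T)..T, f t := by
    have : (fun T : ℝ => ∫ t in (-T)..T, f t) =
        fun T => (∫ t in (0 : ℝ)..T, f t) - ∫ t in (0 : ℝ)..(-T), f t := by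
      funext T
      rw [intervalIntegral.integral_interval_sub_left (hf.intervalIntegrable _ _)
        (hf.intervalIntegrable _ _)]
    rw [this]
    exact hp.sub (hp.comp continuous_neg)
  have hm : Measurable fun T : ℝ => (2 * T)⁻¹ := by fun_prop
  exact hm.aestronglyMeasurable.smul hc.aestronglyMeasurable

end WaveErgodic

/-! ### Assembly of the estimates -/

theorem mainTheorem5 (d : ℕ) (hd : 1 ≤ d) (s : ℝ) (hs : 1 / 2 < s) :
    -- the flow of `K` is well defined, and its time averages decay
    (∀ F₀ : WaveErgodic.L2Sum d, ∃! F : ℝ → WaveErgodic.L2Sum d,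
      WaveErgodic.IsFlowOfK F₀ F) ∧
    (∀ ℓ : ℝ, ℓ < 1 → ∃ C : ℝ, ∀ (F₀ : WaveErgodic.L2Sum d) (F : ℝ → WaveErgodic.L2Sum d),
      WaveErgodic.MemL2s s F₀.fst → WaveErgodic.MemL2s s F₀.snd →
      WaveErgodic.IsFlowOfK F₀ F → ∀ T : ℝ, 1 < T →
        ‖WaveErgodic.timeAverage F T‖ ≤ C * T ^ (-(ℓ / 2)) *
          Real.sqrt (WaveErgodic.normL2s s F₀.fst ^ 2 + WaveErgodic.normL2s s F₀.snd ^ 2)) ∧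
    -- the wave equation is well posed, and it is equivalent to the first-order system
    (∀ (f₀ : WaveErgodic.L2 d) (g₀ : 𝓢'(WaveErgodic.Space d, ℂ)) (h₀ : WaveErgodic.L2 d),
      WaveErgodic.IsInvSqrtH g₀ h₀ →
        (∃! f : ℝ → WaveErgodic.L2 d, WaveErgodic.IsWaveSolution f₀ g₀ f) ∧
        ∀ (f : ℝ → WaveErgodic.L2 d) (F : ℝ → WaveErgodic.L2Sum d),
          WaveErgodic.IsWaveSolution f₀ g₀ f →
          WaveErgodic.IsFlowOfK (WithLp.toLp 2
            ((1 / 2 : ℂ) • (f₀ + Complex.I • h₀), (1 / 2 : ℂ) • (f₀ - Complex.I • h₀))) F →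
          ∀ t : ℝ, f t = (F t).fst + (F t).snd) ∧
    -- the time averages of the solution of the wave equation decay
    (∀ ℓ : ℝ, ℓ < 1 → ∃ C : ℝ, ∀ (f₀ : WaveErgodic.L2 d) (g₀ : 𝓢'(WaveErgodic.Space d, ℂ))
      (h₀ : WaveErgodic.L2 d) (f : ℝ → WaveErgodic.L2 d),
      WaveErgodic.IsInvSqrtH g₀ h₀ → WaveErgodic.MemL2s s f₀ → WaveErgodic.MemL2s s h₀ →
      WaveErgodic.IsWaveSolution f₀ g₀ f → ∀ T : ℝ, 1 < T →
        ‖WaveErgodic.timeAverage f T‖ ≤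
          C * T ^ (-(ℓ / 2)) * (WaveErgodic.normL2s s f₀ + WaveErgodic.normL2s s h₀)) ∧
    -- the global-in-time estimate
    (∀ q : ℝ≥0∞, 2 < q → ∃ C : ℝ, ∀ (f₀ : WaveErgodic.L2 d) (g₀ : 𝓢'(WaveErgodic.Space d, ℂ))
      (h₀ : WaveErgodic.L2 d) (f : ℝ → WaveErgodic.L2 d),
      WaveErgodic.IsInvSqrtH g₀ h₀ → WaveErgodic.MemL2s s f₀ → WaveErgodic.MemL2s s h₀ →
      WaveErgodic.IsWaveSolution f₀ g₀ f →
        MemLp (WaveErgodic.timeAverage f) q (volume.restrict (Set.Ici (0 : ℝ))) ∧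
        eLpNorm (WaveErgodic.timeAverage f) q (volume.restrict (Set.Ici (0 : ℝ))) ≤
          ENNReal.ofReal (C * (WaveErgodic.normL2s s f₀ + WaveErgodic.normL2s s h₀))) := by
  open WaveErgodic in
  -- Any coordinate direction serves in the slab estimate; `d ≥ 1` provides one.
  let i : Fin d := ⟨0, hd⟩
  refine ⟨existsUnique_isFlowOfK, fun ℓ hℓ => ?_, fun f₀ g₀ h₀ hg => ?_, fun ℓ hℓ => ?_,
    fun q hq => ?_⟩
  · refine ⟨√(1 + 4 * traceConst s), fun F₀ F h1 h2 hF T hT => ?_⟩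
    refine (hF.norm_timeAverage_le hs i h1 h2 (by linarith)).trans ?_
    gcongr
    exact one_add_rpow_le hℓ hT
  · exact ⟨⟨_, hg.isWaveSolution, fun f hf => hf.unique hg.isWaveSolution⟩,
      fun f F hf hF t => hf.eq_flow hg hF t⟩
  · refine ⟨2 * √(1 + 4 * traceConst s), fun f₀ g₀ h₀ f hg h1 h2 hf T hT => ?_⟩
    refine (hf.norm_timeAverage_le hs i hg h1 h2 (by linarith)).trans ?_
    have hN := add_nonneg (normL2s_nonneg s f₀) (normL2s_nonneg s h₀)
    gcongr
    exact one_add_rpow_le hℓ hT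
  · have hw := (memLp_decay hq).mono_measure (Measure.restrict_le_self (s := Set.Ici (0 : ℝ)))
    set A := eLpNorm (fun T : ℝ => (1 + ‖T‖) ^ (-(1 / 2) : ℝ)) q
      (volume.restrict (Set.Ici (0 : ℝ))) with hA
    refine ⟨2 * √(1 + 4 * traceConst s) * A.toReal, fun f₀ g₀ h₀ f hg h1 h2 hf => ?_⟩
    have hN := add_nonneg (normL2s_nonneg s f₀) (normL2s_nonneg s h₀)
    have hb : ∀ᵐ T ∂(volume.restrict (Set.Ici (0 : ℝ))), ‖timeAverage f T‖ ≤
        2 * √(1 + 4 * traceConst s) * (normL2s s f₀ + normL2s s h₀) *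
          ‖(1 + ‖T‖) ^ (-(1 / 2) : ℝ)‖ := by
      refine (ae_restrict_mem measurableSet_Ici).mono fun T hT => ?_
      rcases (Set.mem_Ici.mp hT).eq_or_lt with rfl | hT
      -- At `T = 0` the convention `0⁻¹ = 0` and the empty interval make the average vanish.
      · have : timeAverage f 0 = 0 := by simp [timeAverage]
        rw [this, norm_zero]
        positivity
      · rw [Real.norm_of_nonneg (by positivity : 0 ≤ (1 + ‖T‖) ^ (-(1 / 2) : ℝ)),
          Real.norm_of_nonneg hT.le, mul_right_comm]
        exact hf.norm_timeAverage_le hs i hg h1 h2 hT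
    refine ⟨hw.of_le_mul (aestronglyMeasurable_timeAverage hf.1 _) hb, ?_⟩
    refine (eLpNorm_le_mul_eLpNorm_of_ae_le_mul hb q).trans_eq ?_
    -- The decay profile has finite `L^q` norm, so passing to a real constant loses nothing.
    have hA' : ENNReal.ofReal A.toReal = A := ENNReal.ofReal_toReal hw.2.ne
    rw [← hA, ← hA', ENNReal.toReal_ofReal ENNReal.toReal_nonneg, ← ENNReal.ofReal_mul (by positivity)]
    congr 1
    ring
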